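/- Let $n \in \mathbf{N}$, $1 \le p,q < \infty$ and $s \in \mathbf{R}$, and suppose that either $s > n/q'$, where $\frac1q + \frac1{q'} = 1$, or $q = 1$ and $s \ge 0$. Fix a window $g \in \mathcal{S}(\mathbf{R}^n) \setminus \{0\}$. For $f \in \mathcal{S}'(\mathbf{R}^n)$ let $$V_g f(x,\xi) = \langle f, M_\xi T_x g\rangle = \int_{\mathbf{R}^n} f(t)\,\overline{g(t-x)}\,e^{-i t\cdot\xi}\,dt$$ (in the sense of the duality between $\mathcal{S}'$ and $\mathcal{S}$) be its short-time Fourier transform, and let the modulation space $M^{p,q}_s(\mathbf{R}^n)$ consist of all $f \in \mathcal{S}'(\mathbf{R}^n)$ for which $$\|f\|_{M^{p,q}_s} = \Big(\int_{\mathbf{R}^n} (1+|\xi|^2)^{sq/2} \Big(\int_{\mathbf{R}^n} |V_g f(x,\xi)|^p\,dx\Big)^{q/p} d\xi\Big)^{1/q}$$ is finite. Then for every $f \in M^{p,q}_s(\mathbf{R}^n)$ and every $\varepsilon > 0$ there is $\phi \in C_c^\infty(\mathbf{R}^n)$ (complex-valued, smooth, compactly supported) such that $\|f - \phi f\|_{M^{p,q}_s}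 < \varepsilon$. -/

import Mathlib

open MeasureTheory SchwartzMap
open scoped ENNReal ContDiff

noncomputable section

/-- The character `t ↦ e^{i t·ξ}` on `ℝⁿ`. -/
def planeWave {n : ℕ} (ξ t : EuclideanSpace ℝ (Fin n)) : ℂ :=
  Complex.exp (((inner ℝ t ξ : ℝ) : ℂ) * Complex.I)

theorem hasTemperateGrowth_exp_mul_I :
    Function.HasTemperateGrowth (fun r : ℝ => Complex.exp ((r : ℂ) * Complex.I)) := by
  have hd : ∀ k : ℕ, iteratedDeriv k (fun r : ℝ => Complex.exp ((r : ℂ) * Complex.I)) =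
      fun r : ℝ => Complex.I ^ k * Complex.exp ((r : ℂ) * Complex.I) := by
    intro k
    induction k with
    | zero => simp
    | succ k ih =>
      rw [iteratedDeriv_succ, ih]
      funext r
      have h1 : HasDerivAt (fun r : ℝ => (r : ℂ) * Complex.I) (1 * Complex.I) r :=
        (Complex.ofRealCLM.hasDerivAt (x := r)).mul_const Complex.I
      rw [(h1.cexp.const_mul (Complex.I ^ k)).deriv]
      ring
  refine ⟨?_, fun k => ⟨0, 1, fun r => ?_⟩⟩
  · exact (Complex.ofRealCLM.contDiff.mul contDiff_const).cexp
  · rw [norm_iteratedFDeriv_eq_norm_iteratedDeriv, hd]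
    simp [Complex.norm_exp_ofReal_mul_I]

theorem hasTemperateGrowth_planeWave {n : ℕ} (ξ : EuclideanSpace ℝ (Fin n)) :
    Function.HasTemperateGrowth (planeWave ξ) :=
  hasTemperateGrowth_exp_mul_I.comp (Function.hasTemperateGrowth_inner_left ξ)

/-- The translation operator, `(T_x h)(t) = h(t - x)`. -/
def translationOp {n : ℕ} (x : EuclideanSpace ℝ (Fin n))
    (h : 𝓢(EuclideanSpace ℝ (Fin n), ℂ)) : 𝓢(EuclideanSpace ℝ (Fin n), ℂ) :=
  compSubConstCLM ℂ x h

/-- The modulation operator, `(M_ξ h)(t) = e^{i t·ξ} h(t)`. -/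
def modulationOp {n : ℕ} (ξ : EuclideanSpace ℝ (Fin n))
    (h : 𝓢(EuclideanSpace ℝ (Fin n), ℂ)) : 𝓢(EuclideanSpace ℝ (Fin n), ℂ) :=
  SchwartzMap.smulLeftCLM ℂ (planeWave ξ) h

/-- The complex conjugate of a Schwartz function. -/
def conjSchwartz {n : ℕ} (h : 𝓢(EuclideanSpace ℝ (Fin n), ℂ)) :
    𝓢(EuclideanSpace ℝ (Fin n), ℂ) :=
  postcompCLM (𝕜 := ℝ) (Complex.conjCLE : ℂ →L[ℝ] ℂ) h

/-- The short-time Fourier transform of a tempered distribution `f` with window `g`,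
`V_g f (x, ξ) = ⟨f, M_ξ T_x g⟩ = "∫ f(t) conj(g(t - x)) e^{-i t·ξ} dt"`.  The bracket `⟨f, h⟩` is
antilinear in `h`: it is the (bilinear) pairing of `f` with the conjugate of `h`. -/
def stft {n : ℕ} (g : 𝓢(EuclideanSpace ℝ (Fin n), ℂ)) (f : 𝓢'(EuclideanSpace ℝ (Fin n), ℂ))
    (x ξ : EuclideanSpace ℝ (Fin n)) : ℂ :=
  f (conjSchwartz (modulationOp ξ (translationOp x g)))

/-- The test function used in `stft` is `t ↦ conj(e^{i t·ξ} g(t - x))`. -/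
theorem conjSchwartz_modulationOp_translationOp_apply {n : ℕ}
    (g : 𝓢(EuclideanSpace ℝ (Fin n), ℂ)) (x ξ t : EuclideanSpace ℝ (Fin n)) :
    conjSchwartz (modulationOp ξ (translationOp x g)) t =
      (starRingEnd ℂ) (planeWave ξ t * g (t - x)) := by
  simp [conjSchwartz, modulationOp, translationOp, hasTemperateGrowth_planeWave,
    smulLeftCLM_apply_apply]

/-- The modulation space (extended) norm with respect to the window `g`,
`‖f‖_{M^{p,q}_s} = ‖ ξ ↦ ⟨ξ⟩^s ‖V_g f(·, ξ)‖_{L^p} ‖_{L^q}` where `⟨ξ⟩ = (1 + |ξ|²)^{1/2}`. -/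
def modulationNorm {n : ℕ} (g : 𝓢(EuclideanSpace ℝ (Fin n), ℂ)) (p q : ℝ≥0∞) (s : ℝ)
    (f : 𝓢'(EuclideanSpace ℝ (Fin n), ℂ)) : ℝ≥0∞ :=
  eLpNorm (fun ξ : EuclideanSpace ℝ (Fin n) =>
    ENNReal.ofReal (Real.sqrt (1 + ‖ξ‖ ^ 2) ^ s) *
      eLpNorm (fun x : EuclideanSpace ℝ (Fin n) => stft g f x ξ) p volume) q volume

/-- The modulation space `M^{p,q}_s(ℝⁿ)`: the tempered distributions of finite modulation norm
with respect to the window `g`. -/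
def modulationSpace {n : ℕ} (g : 𝓢(EuclideanSpace ℝ (Fin n), ℂ)) (p q : ℝ≥0∞) (s : ℝ) :
    Set (𝓢'(EuclideanSpace ℝ (Fin n), ℂ)) :=
  {f | modulationNorm g p q s f < ⊤}

end

noncomputable section

open Filter Topology FourierTransform
open scoped BoundedContinuousFunction

/-! The multiplier is a dilated bump `φ(t) = b(c • t)` with `b 0 = 1` and `c` small. Fourier
inversion writes `φ` as a superposition of plane waves of frequency `2πcη` with density `ψ = 𝓕 b`,
and `∫ ψ = b 0 = 1`. Multiplication by a plane wave shifts the frequency variable of the short-time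
Fourier transform, hence `V_g (f - φ f)(x, ξ) = ∫ ψ(η) (V_g f(x, ξ) - V_g f(x, ξ - 2πcη)) dη`
(`stft_sub_smulLeftCLM`).

Minkowski's integral inequality bounds the modulation norm of `f - φ f` by the average, against
`|ψ|`, of the weighted mixed norms of these frequency differences
(`mixedNorm_integral_sub_translate_le`). Since both exponents are finite and the weight is moderate,
each difference tends to zero as `c → 0` (`tendsto_mixedNorm_sub_translate`). The differences grow
at most polynomially in `η` while `ψ` is Schwartz, so dominated convergence applies to the average
(`tendsto_lintegral_mixedNorm_sub_translate`).

The identity for `V_g` requires moving `f` inside an integral of Schwartz functions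
(`TemperedDistribution.apply_eq_integral`). Continuity bounds `f` by finitely many seminorms, so by
Hahn–Banach it factors through a finite product of Banach spaces, where Bochner integration commutes
with functionals. -/

/-! ### Functionals and integrals through Banach spaces. -/

/-- A linear functional dominated by `‖J ·‖` factors through the linear map `J`. -/
theorem LinearMap.exists_strongDual_apply_eq {V X : Type*} [AddCommGroup V] [Module ℂ V]
    [NormedAddCommGroup X] [NormedSpace ℂ X] (J : V →ₗ[ℂ] X) (f : V →ₗ[ℂ] ℂ) (C : ℝ)
    (h : ∀ v, ‖f v‖ ≤ C * ‖J v‖) : ∃ L : X →L[ℂ] ℂ, ∀ v, L (J v) = f v := by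
  obtain ⟨σ, hσ⟩ := J.rangeRestrict.exists_rightInverse_of_surjective J.range_rangeRestrict
  have hJσ : ∀ y, J (σ y) = y := fun y => congrArg Subtype.val (LinearMap.congr_fun hσ y)
  let L₀ : LinearMap.range J →L[ℂ] ℂ := (f ∘ₗ σ).mkContinuous C fun y => by
    simpa [hJσ] using h (σ y)
  obtain ⟨L, hL, -⟩ := exists_extension_norm_eq (LinearMap.range J) L₀
  refine ⟨L, fun v => ?_⟩
  have h₁ := hL ⟨J v, v, rfl⟩
  rw [h₁]
  -- `σ (J v)` and `v` differ by an element of `ker J`, where the bound forces `f` to vanish; the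
  -- choice of section is therefore immaterial.
  have h₂ : ‖f (σ ⟨J v, v, rfl⟩ - v)‖ ≤ 0 := by simpa [hJσ] using h (σ ⟨J v, v, rfl⟩ - v)
  have h₃ := norm_le_zero_iff.1 h₂
  rw [map_sub, sub_eq_zero] at h₃
  exact h₃

/-- `V` carries no topology, so the integral is taken in the finite product of the Banach spaces `X
i`, through which `f` factors. There it is computed coordinate by coordinate. -/
theorem LinearMap.apply_eq_integral {V α ι : Type*} [AddCommGroup V] [Module ℂ V] [Fintype ι]
    {X : ι → Type*} [∀ i, NormedAddCommGroup (X i)] [∀ i, NormedSpace ℂ (X i)]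
    [∀ i, CompleteSpace (X i)] [MeasurableSpace α] {μ : Measure α} {H : α → V} {v : V}
    (J : ∀ i, V →ₗ[ℂ] X i) (f : V →ₗ[ℂ] ℂ) (C : ℝ) (hf : ∀ w, ‖f w‖ ≤ C * ‖fun i => J i w‖)
    (hint : ∀ i, Integrable (fun a => J i (H a)) μ)
    (hv : ∀ i, Integrable (fun a => J i (H a)) μ → J i v = ∫ a, J i (H a) ∂μ) :
    f v = ∫ a, f (H a) ∂μ := by
  obtain ⟨L, hL⟩ := LinearMap.exists_strongDual_apply_eq (LinearMap.pi J) f C hf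
  have hJint : Integrable (fun a => LinearMap.pi J (H a)) μ := Integrable.of_eval hint
  have hJv : LinearMap.pi J v = ∫ a, LinearMap.pi J (H a) ∂μ := by
    ext1 i
    exact (hv i (hint i)).trans (eval_integral hint i).symm
  rw [← hL, hJv, ← L.integral_comp_comm hJint]
  simp only [hL]

/-- Differentiation under the integral sign, read through an isometry. -/
theorem LinearIsometryEquiv.map_fderiv_integral {E G G' α : Type*} [NormedAddCommGroup E]
    [NormedSpace ℝ E] [NormedAddCommGroup G] [NormedSpace ℝ G] [NormedAddCommGroup G']
    [NormedSpace ℝ G'] [MeasurableSpace α] {μ : Measure α}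
    (e : (E →L[ℝ] G) ≃ₗᵢ[ℝ] G') {Φ : α → E → G} {b : α → ℝ} (hb : Integrable b μ)
    (hΦ : ∀ x, Integrable (fun a => Φ a x) μ) {x : E}
    (hm : AEStronglyMeasurable (fun a => e (fderiv ℝ (Φ a) x)) μ)
    (hle : ∀ a y, ‖fderiv ℝ (Φ a) y‖ ≤ b a) (hd : ∀ a, Differentiable ℝ (Φ a)) :
    e (fderiv ℝ (fun y => ∫ a, Φ a y ∂μ) x) = ∫ a, e (fderiv ℝ (Φ a) x) ∂μ := by
  have hm' : AEStronglyMeasurable (fun a => fderiv ℝ (Φ a) x) μ := by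
    simpa using e.symm.continuous.comp_aestronglyMeasurable hm
  rw [(hasFDerivAt_integral_of_dominated_of_fderiv_le (s := Set.univ)
    (F' := fun x a => fderiv ℝ (Φ a) x) (bound := b) univ_mem (.of_forall fun y => (hΦ y).1)
    (hΦ x) hm' (.of_forall fun a y _ => hle a y) hb
    (.of_forall fun a y _ => (hd a y).hasFDerivAt)).fderiv]
  exact (e.toContinuousLinearEquiv.integral_comp_comm _).symm

/-! ### Schwartz seminorms as sup norms, and integrals of Schwartz functions. -/

namespace SchwartzMap

variable {E F : Type*} [NormedAddCommGroup E] [NormedSpace ℝ E]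
  [NormedAddCommGroup F] [NormedSpace ℝ F]

variable (E F) in
/-- Bounded continuous functions with values in the `m`-multilinear maps. -/
def DerivSpace (m : ℕ) : Type _ := E →ᵇ E [×m]→L[ℝ] F

namespace DerivSpace

variable (m : ℕ)

instance : NormedAddCommGroup (DerivSpace E F m) :=
  inferInstanceAs (NormedAddCommGroup (E →ᵇ E [×m]→L[ℝ] F))

instance : NormedSpace ℝ (DerivSpace E F m) :=
  inferInstanceAs (NormedSpace ℝ (E →ᵇ E [×m]→L[ℝ] F))

instance [NormedSpace ℂ F] [SMulCommClass ℝ ℂ F] : NormedSpace ℂ (DerivSpace E F m) :=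
  inferInstanceAs (NormedSpace ℂ (E →ᵇ E [×m]→L[ℝ] F))

instance [CompleteSpace F] : CompleteSpace (DerivSpace E F m) :=
  inferInstanceAs (CompleteSpace (E →ᵇ E [×m]→L[ℝ] F))

/-- Evaluation at a point. -/
def eval (x : E) : DerivSpace E F m →L[ℝ] E [×m]→L[ℝ] F :=
  BoundedContinuousFunction.evalCLM ℝ x

variable {m}

theorem ext {u v : DerivSpace E F m} (h : ∀ x, eval m x u = eval m x v) : u = v :=
  BoundedContinuousFunction.ext h

theorem norm_eval_le (u : DerivSpace E F m) (x : E) : ‖eval m x u‖ ≤ ‖u‖ :=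
  BoundedContinuousFunction.norm_coe_le_norm u x

theorem norm_le {u : DerivSpace E F m} {C : ℝ} (hC : 0 ≤ C) (h : ∀ x, ‖eval m x u‖ ≤ C) :
    ‖u‖ ≤ C :=
  (BoundedContinuousFunction.norm_le hC).2 h

end DerivSpace

variable [NormedSpace ℂ F] [SMulCommClass ℝ ℂ F]

/-- The map `h ↦ ‖·‖ ^ k • D ^ m h` from Schwartz functions to bounded continuous functions. -/
def weightedDerivCLM (k m : ℕ) : 𝓢(E, F) →L[ℂ] DerivSpace E F m :=
  mkCLMtoNormedSpace (𝕜 := ℂ) (𝕜' := ℂ) (D := E) (E := F) (G := DerivSpace E F m)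
    (fun h : 𝓢(E, F) => BoundedContinuousFunction.ofNormedAddCommGroup
      (fun x => ‖x‖ ^ k • iteratedFDeriv ℝ m h x)
      ((continuous_norm.pow k).smul ((h.smooth m).continuous_iteratedFDeriv le_rfl))
      (SchwartzMap.seminorm ℝ k m h)
      (fun x => by simpa [norm_smul] using h.le_seminorm ℝ k m x))
    (fun f g => DerivSpace.ext fun x => by
      change ‖x‖ ^ k • iteratedFDeriv ℝ m (⇑f + ⇑g) x = _
      rw [iteratedFDeriv_add_apply ((f.smooth m).contDiffAt) ((g.smooth m).contDiffAt), smul_add]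
      rfl)
    (fun a f => DerivSpace.ext fun x => by
      change ‖x‖ ^ k • iteratedFDeriv ℝ m (a • ⇑f) x = _
      rw [iteratedFDeriv_const_smul_apply ((f.smooth m).contDiffAt), smul_comm]
      rfl)
    ⟨{(k, m)}, 1, zero_le_one, fun h => by
      rw [one_mul, Finset.sup_singleton]
      exact BoundedContinuousFunction.norm_ofNormedAddCommGroup_le _ (apply_nonneg _ _) _⟩

theorem eval_weightedDerivCLM (k m : ℕ) (h : 𝓢(E, F)) (x : E) :
    DerivSpace.eval m x (weightedDerivCLM k m h) = ‖x‖ ^ k • iteratedFDeriv ℝ m h x := rfl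

theorem norm_weightedDerivCLM_le (k m : ℕ) (h : 𝓢(E, F)) :
    ‖weightedDerivCLM k m h‖ ≤ SchwartzMap.seminorm ℝ k m h := by
  refine DerivSpace.norm_le (apply_nonneg _ _) fun x => ?_
  simpa [eval_weightedDerivCLM, norm_smul] using h.le_seminorm ℝ k m x

/-- Together with the opposite bound, this identifies each Schwartz seminorm with a Banach norm
pulled back along a linear map, as the factorisation of `f` requires. -/
theorem seminorm_le_norm_weightedDerivCLM (k m : ℕ) (h : 𝓢(E, F)) :
    SchwartzMap.seminorm ℂ k m h ≤ ‖weightedDerivCLM k m h‖ := by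
  refine h.seminorm_le_bound ℂ k m (norm_nonneg (weightedDerivCLM k m h)) fun x => ?_
  simpa [eval_weightedDerivCLM, norm_smul] using DerivSpace.norm_eval_le (weightedDerivCLM k m h) x

theorem continuous_iteratedFDeriv_apply (m : ℕ) (x : E) :
    Continuous fun h : 𝓢(E, F) => iteratedFDeriv ℝ m h x := by
  have : (fun h : 𝓢(E, F) => iteratedFDeriv ℝ m h x) = fun h =>
      DerivSpace.eval m x (weightedDerivCLM 0 m h) := by
    ext1 h
    simp [eval_weightedDerivCLM]
  rw [this]
  exact (DerivSpace.eval m x).continuous.comp (weightedDerivCLM 0 m).continuous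

variable {α : Type*} [TopologicalSpace α] [MeasurableSpace α] [OpensMeasurableSpace α]
  [SecondCountableTopology α] {μ : Measure α} {H : α → 𝓢(E, F)}

theorem integrable_iteratedFDeriv_apply (hH : Continuous H)
    (hint : ∀ k m, Integrable (fun a => SchwartzMap.seminorm ℝ k m (H a)) μ) (m : ℕ) (x : E) :
    Integrable (fun a => iteratedFDeriv ℝ m (H a) x) μ :=
  (hint 0 m).mono' ((continuous_iteratedFDeriv_apply m x).comp hH).aestronglyMeasurable
    (.of_forall fun a => norm_iteratedFDeriv_le_seminorm ℝ (H a) m x)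

/-- Induction on `m`: the seminorm of index `(0, m + 1)` dominates the next derivative uniformly in
the point, which permits differentiation under the integral sign. -/
theorem iteratedFDeriv_integral [CompleteSpace F] (hH : Continuous H)
    (hint : ∀ k m, Integrable (fun a => SchwartzMap.seminorm ℝ k m (H a)) μ) (m : ℕ) :
    iteratedFDeriv ℝ m (fun x => ∫ a, H a x ∂μ) = fun x => ∫ a, iteratedFDeriv ℝ m (H a) x ∂μ := by
  induction m with
  | zero =>
    ext1 x
    rw [iteratedFDeriv_zero_eq_comp]
    simp only [iteratedFDeriv_zero_eq_comp, Function.comp_apply]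
    exact (((continuousMultilinearCurryFin0 ℝ E F).symm.toContinuousLinearEquiv).integral_comp_comm
      (fun a => H a x)).symm
  | succ m ih =>
    ext1 x
    rw [iteratedFDeriv_succ_eq_comp_left, Function.comp_apply, ih]
    exact LinearIsometryEquiv.map_fderiv_integral
      (continuousMultilinearCurryLeftEquiv ℝ (fun _ : Fin (m + 1) => E) F).symm
      (Φ := fun a => iteratedFDeriv ℝ m (H a)) (hint 0 (m + 1))
      (fun y => integrable_iteratedFDeriv_apply hH hint m y)
      (integrable_iteratedFDeriv_apply hH hint (m + 1) x).1
      (fun a y => by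
        rw [norm_fderiv_iteratedFDeriv]
        exact norm_iteratedFDeriv_le_seminorm ℝ (H a) (m + 1) y)
      (fun a => ((H a).smooth (m + 1 : ℕ)).differentiable_iteratedFDeriv
        (by exact_mod_cast Nat.lt_succ_self m))

end SchwartzMap

/-- A tempered distribution commutes with integrals of Schwartz-valued functions. -/
theorem TemperedDistribution.apply_eq_integral {E α : Type*} [NormedAddCommGroup E]
    [NormedSpace ℝ E] [TopologicalSpace α] [MeasurableSpace α] [OpensMeasurableSpace α]
    [SecondCountableTopology α] {μ : Measure α} {H : α → 𝓢(E, ℂ)} (hH : Continuous H)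
    (hint : ∀ k m, Integrable (fun a => SchwartzMap.seminorm ℝ k m (H a)) μ)
    (f : 𝓢'(E, ℂ)) (h : 𝓢(E, ℂ)) (hh : ∀ x, h x = ∫ a, H a x ∂μ) :
    f h = ∫ a, f (H a) ∂μ := by
  have hfc : Continuous fun k : 𝓢(E, ℂ) => ‖f k‖ := (map_continuous f).norm
  obtain ⟨s, C, -, hC⟩ := Seminorm.bound_of_continuous (schwartz_withSeminorms ℂ E ℂ)
    ((normSeminorm ℂ ℂ).comp (f : 𝓢(E, ℂ) →L[ℂ] ℂ).toLinearMap) hfc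
  refine LinearMap.apply_eq_integral (X := fun i : s => SchwartzMap.DerivSpace E ℂ i.1.2)
    (fun i => (SchwartzMap.weightedDerivCLM i.1.1 i.1.2).toLinearMap)
    (f : 𝓢(E, ℂ) →L[ℂ] ℂ).toLinearMap C (fun k => ?_) (fun i => ?_) (fun i hJi => ?_)
  · refine (hC k).trans ?_
    change (C : ℝ) * _ ≤ _
    gcongr
    refine Seminorm.finset_sup_apply_le (norm_nonneg _) fun i hi => ?_
    exact (SchwartzMap.seminorm_le_norm_weightedDerivCLM i.1 i.2 k).trans
      (norm_le_pi_norm (fun i : s => SchwartzMap.weightedDerivCLM i.1.1 i.1.2 k) ⟨i, hi⟩)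
  · exact (hint i.1.1 i.1.2).mono'
      ((SchwartzMap.weightedDerivCLM i.1.1 i.1.2).continuous.comp hH).aestronglyMeasurable
      (.of_forall fun a => SchwartzMap.norm_weightedDerivCLM_le _ _ _)
  · refine SchwartzMap.DerivSpace.ext fun x => ?_
    refine Eq.trans ?_ ((SchwartzMap.DerivSpace.eval i.1.2 x).integral_comp_comm hJi)
    change ‖x‖ ^ i.1.1 • iteratedFDeriv ℝ i.1.2 h x =
      ∫ a, ‖x‖ ^ i.1.1 • iteratedFDeriv ℝ i.1.2 (H a) x ∂μ
    rw [integral_smul, funext hh, SchwartzMap.iteratedFDeriv_integral hH hint]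

/-! ### Translations on Schwartz space: continuity and polynomial growth. -/

namespace SchwartzMap

variable {E F : Type*} [NormedAddCommGroup E] [NormedSpace ℝ E]
  [NormedAddCommGroup F] [NormedSpace ℝ F]

theorem continuous_seminorm (k m : ℕ) :
    Continuous fun h : 𝓢(E, F) => SchwartzMap.seminorm ℝ k m h :=
  (schwartz_withSeminorms ℝ E F).continuous_seminorm (k, m)

variable (E F) in
/-- A seminorm dominating `(1 + ‖x‖) ^ k * ‖D ^ m h x‖`. -/
def decaySeminorm (k m : ℕ) : Seminorm ℝ 𝓢(E, F) :=
  (2 ^ k : NNReal) • (Finset.Iic (k, m)).sup (schwartzSeminormFamily ℝ E F)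

theorem le_decaySeminorm (k m : ℕ) (h : 𝓢(E, F)) (x : E) :
    (1 + ‖x‖) ^ k * ‖iteratedFDeriv ℝ m h x‖ ≤ decaySeminorm E F k m h :=
  one_add_le_sup_seminorm_apply (𝕜 := ℝ) (m := (k, m)) le_rfl le_rfl h x

theorem continuous_decaySeminorm (k m : ℕ) : Continuous (decaySeminorm E F k m) := by
  have : Continuous ⇑((Finset.Iic (k, m)).sup (schwartzSeminormFamily ℝ E F)) :=
    Seminorm.continuous_finsetSup fun i _ =>
      (schwartz_withSeminorms ℝ E F).continuous_seminorm i
  exact this.const_smul (2 ^ k : NNReal)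

theorem norm_pow_le_of_norm_sub_le {E : Type*} [NormedAddCommGroup E] {x y a : E}
    (h : ‖x - y‖ ≤ ‖a‖) (k : ℕ) :
    ‖x‖ ^ k ≤ (1 + ‖a‖) ^ k * (1 + ‖y‖) ^ k := by
  rw [← mul_pow]
  gcongr
  have := norm_le_norm_sub_add x y
  nlinarith [norm_nonneg a, norm_nonneg y]

theorem seminorm_compSubConstCLM_le (k m : ℕ) (a : E) (h : 𝓢(E, F)) :
    SchwartzMap.seminorm ℝ k m (h.compSubConstCLM ℝ a) ≤
      (1 + ‖a‖) ^ k * decaySeminorm E F k m h := by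
  refine seminorm_le_bound ℝ k m _ (by positivity) fun x => ?_
  change _ * ‖iteratedFDeriv ℝ m (fun z => h (z - a)) x‖ ≤ _
  rw [iteratedFDeriv_comp_sub]
  calc ‖x‖ ^ k * ‖iteratedFDeriv ℝ m h (x - a)‖
      ≤ ((1 + ‖a‖) ^ k * (1 + ‖x - a‖) ^ k) * ‖iteratedFDeriv ℝ m h (x - a)‖ := by
        gcongr
        exact norm_pow_le_of_norm_sub_le (by simp) k
    _ ≤ _ := by
        rw [mul_assoc]
        gcongr
        exact le_decaySeminorm k m h _

theorem seminorm_compSubConstCLM_sub_le (k m : ℕ) (a : E) (h : 𝓢(E, F)) :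
    SchwartzMap.seminorm ℝ k m (h.compSubConstCLM ℝ a - h) ≤
      (1 + ‖a‖) ^ k * decaySeminorm E F k (m + 1) h * ‖a‖ := by
  refine seminorm_le_bound ℝ k m _ (by positivity) fun x => ?_
  change _ * ‖iteratedFDeriv ℝ m (⇑(h.compSubConstCLM ℝ a) - ⇑h) x‖ ≤ _
  rw [iteratedFDeriv_sub_apply ((smooth _ m).contDiffAt) ((h.smooth m).contDiffAt)]
  change _ * ‖iteratedFDeriv ℝ m (fun z => h (z - a)) x - _‖ ≤ _
  rw [iteratedFDeriv_comp_sub]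
  have hd : Differentiable ℝ (iteratedFDeriv ℝ m h) :=
    (h.smooth (m + 1 : ℕ)).differentiable_iteratedFDeriv (by exact_mod_cast Nat.lt_succ_self m)
  -- Mean value inequality on the segment from `x` to `x - a`. The weight is frozen at `x`; points
  -- `y` of the segment lie within `‖a‖` of `x`, so it costs only a factor `(1 + ‖a‖) ^ k` to
  -- replace it by a weight at `y`.
  have key := (convex_segment x (x - a)).norm_image_sub_le_of_norm_fderiv_le (𝕜 := ℝ)
    (f := fun y => ‖x‖ ^ k • iteratedFDeriv ℝ m h y)
    (C := (1 + ‖a‖) ^ k * decaySeminorm E F k (m + 1) h)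
    (fun y _ => (hd y).fun_const_smul _) (fun y hy => ?_)
    (left_mem_segment ℝ x (x - a)) (right_mem_segment ℝ x (x - a))
  · simpa [← smul_sub, norm_smul] using key
  · rw [fderiv_fun_const_smul (hd y), norm_smul, norm_fderiv_iteratedFDeriv, norm_pow, norm_norm]
    have hxy : ‖x - y‖ ≤ ‖a‖ := by
      have := norm_sub_le_of_mem_segment hy
      rw [norm_sub_rev]
      simpa using this
    calc ‖x‖ ^ k * ‖iteratedFDeriv ℝ (m + 1) h y‖
        ≤ ((1 + ‖a‖) ^ k * (1 + ‖y‖) ^ k) * ‖iteratedFDeriv ℝ (m + 1) h y‖ := by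
          gcongr
          exact norm_pow_le_of_norm_sub_le hxy k
      _ ≤ _ := by
          rw [mul_assoc]
          gcongr
          exact le_decaySeminorm k (m + 1) h y

theorem tendsto_of_seminorm_sub_le {ι : Type*} {l : Filter ι} {H : ι → 𝓢(E, F)} {h : 𝓢(E, F)}
    (b : ℕ → ℕ → ι → ℝ) (hb : ∀ k m, Tendsto (b k m) l (𝓝 0))
    (hle : ∀ k m i, SchwartzMap.seminorm ℝ k m (H i - h) ≤ b k m i) : Tendsto H l (𝓝 h) := by
  rw [(schwartz_withSeminorms ℝ E F).tendsto_nhds]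
  rintro ⟨k, m⟩ ε hε
  filter_upwards [(hb k m).eventually_lt_const hε] with i hi
  exact (hle k m i).trans_lt hi

theorem tendsto_compSubConstCLM_zero (h : 𝓢(E, F)) :
    Tendsto (fun a : E => h.compSubConstCLM ℝ a) (𝓝 0) (𝓝 h) := by
  refine tendsto_of_seminorm_sub_le
    (fun k m a => (1 + ‖a‖) ^ k * decaySeminorm E F k (m + 1) h * ‖a‖) (fun k m => ?_)
    (fun k m a => seminorm_compSubConstCLM_sub_le k m a h)
  have : Continuous fun a : E => (1 + ‖a‖) ^ k * decaySeminorm E F k (m + 1) h * ‖a‖ := by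
    fun_prop
  simpa using this.tendsto 0

/-- Translation is jointly continuous on Schwartz space. -/
theorem continuous_compSubConstCLM :
    Continuous fun z : E × 𝓢(E, F) => z.2.compSubConstCLM ℝ z.1 := by
  rw [continuous_iff_continuousAt]
  rintro ⟨a, h⟩
  -- The varying function is split as `(z.2 - h) + h`. The first part is controlled by seminorms
  -- locally uniform in the translation; for the second, translation by `z.1` is translation by `z.1
  -- - a` followed by translation by `a`.
  have h₁ : Tendsto (fun z : E × 𝓢(E, F) => (z.2 - h).compSubConstCLM ℝ z.1) (𝓝 (a, h))
      (𝓝 0) := by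
    refine tendsto_of_seminorm_sub_le
      (fun k m z => (1 + ‖z.1‖) ^ k * decaySeminorm E F k m (z.2 - h)) (fun k m => ?_)
      (fun k m z => ?_)
    · have hc : Continuous fun z : E × 𝓢(E, F) =>
          (1 + ‖z.1‖) ^ k * decaySeminorm E F k m (z.2 - h) := by
        have := (continuous_decaySeminorm (E := E) (F := F) k m).comp
          (continuous_snd.sub continuous_const : Continuous fun z : E × 𝓢(E, F) => z.2 - h)
        exact ((continuous_const.add continuous_fst.norm).pow k).mul this
      simpa using hc.tendsto (a, h)
    · rw [sub_zero]
      exact seminorm_compSubConstCLM_le k m _ _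
  have h₂ : Tendsto (fun z : E × 𝓢(E, F) => (h.compSubConstCLM ℝ (z.1 - a)).compSubConstCLM ℝ a)
      (𝓝 (a, h)) (𝓝 (h.compSubConstCLM ℝ a)) := by
    refine ((compSubConstCLM ℝ a).continuous.tendsto h).comp
      ((tendsto_compSubConstCLM_zero h).comp ?_)
    have : Continuous fun z : E × 𝓢(E, F) => z.1 - a := by fun_prop
    simpa using this.tendsto (a, h)
  have h₃ := h₁.add h₂
  rw [zero_add] at h₃
  refine h₃.congr fun z => ?_
  rw [compSubConstCLM_comp, sub_add_cancel, map_sub, sub_add_cancel]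

theorem _root_.Continuous.compSubConstCLM {X : Type*} [TopologicalSpace X] {h : X → 𝓢(E, F)}
    {a : X → E} (hh : Continuous h) (ha : Continuous a) :
    Continuous fun z => (h z).compSubConstCLM ℝ (a z) :=
  continuous_compSubConstCLM.comp (ha.prodMk hh)

/-- A continuous linear map applied to translates grows polynomially in the translation. -/
theorem exists_seminorm_comp_compSubConstCLM_le {D G : Type*} [NormedAddCommGroup D]
    [NormedSpace ℝ D] [NormedAddCommGroup G] [NormedSpace ℝ G]
    (L : 𝓢(E, F) →L[ℝ] 𝓢(D, G)) (h : 𝓢(E, F)) (k m : ℕ) :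
    ∃ (C : ℝ) (N : ℕ), 0 ≤ C ∧ ∀ a : E,
      SchwartzMap.seminorm ℝ k m (L (h.compSubConstCLM ℝ a)) ≤ C * (1 + ‖a‖) ^ N := by
  obtain ⟨s, C, -, hC⟩ := Seminorm.bound_of_continuous (schwartz_withSeminorms ℝ E F)
    ((SchwartzMap.seminorm ℝ k m : Seminorm ℝ 𝓢(D, G)).comp L.toLinearMap)
    ((continuous_seminorm k m).comp L.continuous)
  refine ⟨C * ∑ i ∈ s, decaySeminorm E F i.1 i.2 h, s.sup Prod.fst, by positivity, fun a => ?_⟩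
  calc SchwartzMap.seminorm ℝ k m (L (h.compSubConstCLM ℝ a))
      ≤ C * (s.sup (schwartzSeminormFamily ℝ E F)) (h.compSubConstCLM ℝ a) := hC _
    _ ≤ C * ∑ i ∈ s, SchwartzMap.seminorm ℝ i.1 i.2 (h.compSubConstCLM ℝ a) := by
        gcongr
        refine (Seminorm.finset_sup_le_sum _ s _).trans_eq ?_
        change FunLike.coeAddMonoidHom _ _ _ (∑ i ∈ s, schwartzSeminormFamily ℝ E F i) _ = _
        rw [map_sum, Finset.sum_apply]
        rfl
    _ ≤ C * ∑ i ∈ s, decaySeminorm E F i.1 i.2 h * (1 + ‖a‖) ^ s.sup Prod.fst := by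
        gcongr with i hi
        rw [mul_comm]
        refine (seminorm_compSubConstCLM_le i.1 i.2 a h).trans ?_
        gcongr
        · simp
        · exact Finset.le_sup (f := Prod.fst) hi
    _ = _ := by rw [← Finset.sum_mul, mul_assoc]

theorem integrable_one_add_pow_mul [MeasurableSpace E] [BorelSpace E] [SecondCountableTopology E]
    {μ : Measure E} [μ.HasTemperateGrowth] (h : 𝓢(E, F)) (N : ℕ) :
    Integrable (fun x => (1 + ‖x‖) ^ N * ‖h x‖) μ := by
  refine (((h.integrable_pow_mul μ 0).add (h.integrable_pow_mul μ N)).const_mul (2 ^ N)).mono'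
    (by fun_prop) (.of_forall fun x => ?_)
  rw [Real.norm_of_nonneg (by positivity)]
  simp only [Pi.add_apply, ← add_mul, ← mul_assoc]
  gcongr
  refine (add_pow_le zero_le_one (norm_nonneg x) N).trans ?_
  rw [one_pow, pow_zero]
  gcongr
  · norm_num
  · omega

end SchwartzMap

/-! ### Modulations, atoms and the averaging identity for the short-time Fourier transform. -/

variable {n : ℕ}

theorem modulationOp_apply (ξ : EuclideanSpace ℝ (Fin n))
    (h : 𝓢(EuclideanSpace ℝ (Fin n), ℂ)) (t : EuclideanSpace ℝ (Fin n)) :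
    modulationOp ξ h t = planeWave ξ t * h t := by
  simp [modulationOp, smulLeftCLM_apply_apply, hasTemperateGrowth_planeWave]

theorem planeWave_two_pi_smul (v t : EuclideanSpace ℝ (Fin n)) :
    planeWave ((2 * Real.pi) • v) t = (Real.fourierChar (inner ℝ v t) : ℂ) := by
  rw [planeWave, Real.fourierChar_apply, inner_smul_right, real_inner_comm]

theorem fourierInv_compSubConstCLM (a : EuclideanSpace ℝ (Fin n))
    (h : 𝓢(EuclideanSpace ℝ (Fin n), ℂ)) :
    𝓕⁻ (h.compSubConstCLM ℝ a) = modulationOp ((2 * Real.pi) • a) (𝓕⁻ h) := by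
  ext t
  rw [modulationOp_apply, fourierInv_coe, fourierInv_coe, Real.fourierInv_eq, Real.fourierInv_eq,
    planeWave_two_pi_smul, ← integral_const_mul,
    ← integral_sub_right_eq_self (fun v => _ * _) a]
  refine integral_congr_ae (.of_forall fun v => ?_)
  simp only [compSubConstCLM_apply, Circle.smul_def, smul_eq_mul, ← mul_assoc]
  rw [← Circle.coe_mul, ← AddChar.map_add_eq_mul, ← inner_add_left, add_sub_cancel]

/-- Conjugation by the Fourier transform turns modulations into translations, so the continuity and
growth estimates for translations carry over. -/
theorem modulationOp_eq_fourierInv (ξ : EuclideanSpace ℝ (Fin n))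
    (h : 𝓢(EuclideanSpace ℝ (Fin n), ℂ)) :
    modulationOp ξ h = 𝓕⁻ ((𝓕 h).compSubConstCLM ℝ ((2 * Real.pi)⁻¹ • ξ)) := by
  rw [fourierInv_compSubConstCLM, FourierTransform.fourierInv_fourier_eq, smul_smul,
    mul_inv_cancel₀ (by positivity), one_smul]

/-- The test function `t ↦ conj (e^{i t·ξ} g(t - x))` defining the short-time Fourier transform. -/
def stftAtom (g : 𝓢(EuclideanSpace ℝ (Fin n), ℂ)) (x ξ : EuclideanSpace ℝ (Fin n)) :
    𝓢(EuclideanSpace ℝ (Fin n), ℂ) :=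
  conjSchwartz (modulationOp ξ (translationOp x g))

/-- The inverse Fourier transform followed by complex conjugation. -/
def conjFourierInv : 𝓢(EuclideanSpace ℝ (Fin n), ℂ) →L[ℝ] 𝓢(EuclideanSpace ℝ (Fin n), ℂ) :=
  (postcompCLM (𝕜 := ℝ) (Complex.conjCLE : ℂ →L[ℝ] ℂ)).comp
    (fourierInvCLM ℝ 𝓢(EuclideanSpace ℝ (Fin n), ℂ))

theorem stftAtom_eq (g : 𝓢(EuclideanSpace ℝ (Fin n), ℂ)) (x ξ : EuclideanSpace ℝ (Fin n)) :
    stftAtom g x ξ =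
      conjFourierInv ((𝓕 (g.compSubConstCLM ℝ x)).compSubConstCLM ℝ ((2 * Real.pi)⁻¹ • ξ)) := by
  rw [stftAtom, modulationOp_eq_fourierInv]
  rfl

theorem continuous_stftAtom (g : 𝓢(EuclideanSpace ℝ (Fin n), ℂ)) :
    Continuous fun z : EuclideanSpace ℝ (Fin n) × EuclideanSpace ℝ (Fin n) =>
      stftAtom g z.1 z.2 := by
  simp only [stftAtom_eq]
  have h₁ : Continuous fun z : EuclideanSpace ℝ (Fin n) × EuclideanSpace ℝ (Fin n) =>
      g.compSubConstCLM ℝ z.1 := continuous_const.compSubConstCLM continuous_fst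
  have h₂ : Continuous fun z : EuclideanSpace ℝ (Fin n) × EuclideanSpace ℝ (Fin n) =>
      𝓕 (g.compSubConstCLM ℝ z.1) := ContinuousFourier.continuous_fourier.comp h₁
  have h₃ : Continuous fun z : EuclideanSpace ℝ (Fin n) × EuclideanSpace ℝ (Fin n) =>
      (2 * Real.pi)⁻¹ • z.2 := continuous_snd.fun_const_smul _
  exact conjFourierInv.continuous.comp (h₂.compSubConstCLM h₃)

theorem continuous_stftAtom_right (g : 𝓢(EuclideanSpace ℝ (Fin n), ℂ))
    (x : EuclideanSpace ℝ (Fin n)) : Continuous (stftAtom g x) := by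
  have h : Continuous fun ξ : EuclideanSpace ℝ (Fin n) => (x, ξ) := by fun_prop
  have h' := (continuous_stftAtom g).comp h
  exact h'

theorem exists_seminorm_stftAtom_le (g : 𝓢(EuclideanSpace ℝ (Fin n), ℂ))
    (x : EuclideanSpace ℝ (Fin n)) (k m : ℕ) : ∃ (C : ℝ) (N : ℕ), 0 ≤ C ∧ ∀ ξ,
      SchwartzMap.seminorm ℝ k m (stftAtom g x ξ) ≤ C * (1 + ‖ξ‖) ^ N := by
  obtain ⟨C, N, hC, h⟩ := exists_seminorm_comp_compSubConstCLM_le conjFourierInv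
    (𝓕 (g.compSubConstCLM ℝ x)) k m
  refine ⟨C, N, hC, fun ξ => ?_⟩
  rw [stftAtom_eq]
  refine (h _).trans ?_
  gcongr
  rw [norm_smul, norm_inv, Real.norm_of_nonneg (by positivity)]
  refine mul_le_of_le_one_left (norm_nonneg _) (inv_le_one_of_one_le₀ ?_)
  linarith [Real.pi_gt_three]

theorem continuous_stft (g : 𝓢(EuclideanSpace ℝ (Fin n), ℂ))
    (f : 𝓢'(EuclideanSpace ℝ (Fin n), ℂ)) :
    Continuous fun z : EuclideanSpace ℝ (Fin n) × EuclideanSpace ℝ (Fin n) =>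
      stft g f z.1 z.2 :=
  (map_continuous f).comp (continuous_stftAtom g)

theorem continuous_planeWave_left (t : EuclideanSpace ℝ (Fin n)) :
    Continuous fun ξ : EuclideanSpace ℝ (Fin n) => planeWave ξ t := by
  unfold planeWave
  fun_prop

theorem norm_planeWave (ξ t : EuclideanSpace ℝ (Fin n)) : ‖planeWave ξ t‖ = 1 :=
  Complex.norm_exp_ofReal_mul_I _

theorem planeWave_add (ξ ζ t : EuclideanSpace ℝ (Fin n)) :
    planeWave (ξ + ζ) t = planeWave ξ t * planeWave ζ t := by
  simp only [planeWave, inner_add_right, ← Complex.exp_add]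
  push_cast
  ring_nf

theorem conj_planeWave (ξ t : EuclideanSpace ℝ (Fin n)) :
    (starRingEnd ℂ) (planeWave ξ t) = planeWave (-ξ) t := by
  simp [planeWave, ← Complex.exp_conj]

/-- The algebraic core: because the atom is conjugated, multiplying it by a plane wave of frequency
`ζ` lowers its frequency parameter by `ζ`. -/
theorem stftAtom_sub_apply (g : 𝓢(EuclideanSpace ℝ (Fin n), ℂ))
    (x ξ ζ t : EuclideanSpace ℝ (Fin n)) :
    stftAtom g x (ξ - ζ) t = planeWave ζ t * stftAtom g x ξ t := by
  simp only [stftAtom, conjSchwartz_modulationOp_translationOp_apply, map_mul, conj_planeWave]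
  rw [neg_sub, sub_eq_add_neg, planeWave_add, mul_assoc]

/-- The short-time Fourier transform of `f - φ f`, where `φ = ∫ ψ(η) e^{i c t·η} dη` and
`∫ ψ = 1`, is an average of frequency differences of the short-time Fourier transform of `f`. -/
theorem stft_sub_smulLeftCLM (g ψ : 𝓢(EuclideanSpace ℝ (Fin n), ℂ))
    (f : 𝓢'(EuclideanSpace ℝ (Fin n), ℂ)) {φ : EuclideanSpace ℝ (Fin n) → ℂ} {c : ℝ}
    (hφ : φ.HasTemperateGrowth) (hψ : ∫ η, ψ η = 1)
    (hφψ : ∀ t, φ t = ∫ η, ψ η * planeWave (c • η) t) (x ξ : EuclideanSpace ℝ (Fin n)) :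
    stft g (f - TemperedDistribution.smulLeftCLM ℂ φ f) x ξ =
      ∫ η, ψ η * (stft g f x ξ - stft g f x (ξ - c • η)) := by
  set H : EuclideanSpace ℝ (Fin n) → 𝓢(EuclideanSpace ℝ (Fin n), ℂ) :=
    fun η => ψ η • (stftAtom g x ξ - stftAtom g x (ξ - c • η)) with hHdef
  have hH : Continuous H := by
    have h₁ : Continuous fun η : EuclideanSpace ℝ (Fin n) => ξ - c • η := by fun_prop
    exact ψ.continuous.smul (continuous_const.sub ((continuous_stftAtom_right g x).comp h₁))
  -- Seminorms of the atoms grow polynomially in the frequency, and the decay of `ψ` absorbs this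
  -- growth.
  have hint : ∀ k m, Integrable (fun η => SchwartzMap.seminorm ℝ k m (H η)) := by
    intro k m
    obtain ⟨C, N, hC, hb⟩ := exists_seminorm_stftAtom_le g x k m
    refine ((ψ.integrable_one_add_pow_mul (μ := volume) N).const_mul
      (2 * C * (1 + ‖ξ‖ + |c|) ^ N)).mono'
      ((continuous_seminorm k m).comp hH).aestronglyMeasurable (.of_forall fun η => ?_)
    rw [Real.norm_of_nonneg (apply_nonneg _ _)]
    have hbd : ∀ ζ, ‖ζ‖ ≤ ‖ξ‖ + |c| * ‖η‖ → SchwartzMap.seminorm ℝ k m (stftAtom g x ζ) ≤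
        C * ((1 + ‖ξ‖ + |c|) ^ N * (1 + ‖η‖) ^ N) := by
      intro ζ hζ
      refine (hb ζ).trans ?_
      rw [← mul_pow]
      gcongr
      nlinarith [norm_nonneg ξ, norm_nonneg η, abs_nonneg c]
    have h₁ := hbd ξ (le_add_of_nonneg_right (by positivity))
    have h₂ := hbd (ξ - c • η) ((norm_sub_le _ _).trans_eq (by rw [norm_smul, Real.norm_eq_abs]))
    have h₃ : SchwartzMap.seminorm ℝ k m (H η) = ‖ψ η‖ *
        SchwartzMap.seminorm ℝ k m (stftAtom g x ξ - stftAtom g x (ξ - c • η)) :=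
      map_smul_eq_mul (SchwartzMap.seminorm ℂ k m) (ψ η) _
    rw [h₃]
    calc _ ≤ ‖ψ η‖ * (C * ((1 + ‖ξ‖ + |c|) ^ N * (1 + ‖η‖) ^ N) +
          C * ((1 + ‖ξ‖ + |c|) ^ N * (1 + ‖η‖) ^ N)) := by
          gcongr
          exact (map_sub_le_add _ _ _).trans (add_le_add h₁ h₂)
      _ = _ := by ring
  -- Multiplication of a distribution by `φ` is dual to multiplication of test functions, so only an
  -- identity between Schwartz functions remains.
  have hφ' : stft g (f - TemperedDistribution.smulLeftCLM ℂ φ f) x ξ =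
      f (stftAtom g x ξ - SchwartzMap.smulLeftCLM ℂ φ (stftAtom g x ξ)) := by
    rw [map_sub]
    rfl
  rw [hφ', TemperedDistribution.apply_eq_integral hH hint]
  · refine integral_congr_ae (.of_forall fun η => ?_)
    simp only [hHdef, map_smul, map_sub, smul_eq_mul]
    rfl
  · intro t
    rw [sub_apply, smulLeftCLM_apply_apply hφ, hφψ, smul_eq_mul]
    simp only [hHdef, smul_apply, sub_apply, stftAtom_sub_apply, smul_eq_mul]
    have hψi : Integrable fun η => ψ η * planeWave (c • η) t := by
      refine ψ.integrable.mono (ψ.continuous.mul ?_).aestronglyMeasurable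
        (.of_forall fun η => ?_)
      · exact (continuous_planeWave_left t).comp (continuous_const_smul c)
      · rw [norm_mul, norm_planeWave, mul_one]
    calc _ = (∫ η, ψ η * stftAtom g x ξ t) -
          ∫ η, ψ η * planeWave (c • η) t * stftAtom g x ξ t := by
          rw [integral_mul_const, integral_mul_const, hψ, one_mul]
      _ = _ := by
          rw [← integral_sub (ψ.integrable.mul_const _) (hψi.mul_const _)]
          congr 1
          ext η
          ring

/-! ### Minkowski's integral inequality for extended nonnegative functions. -/

section LintegralLp

variable {α β : Type*} [MeasurableSpace α] [MeasurableSpace β] {μ : Measure α} {ν : Measure β}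
  {r : ℝ}

/-- The `L^r` norm of an extended nonnegative function, for a real exponent `r`. -/
def lintegralLp (r : ℝ) (μ : Measure α) (f : α → ℝ≥0∞) : ℝ≥0∞ :=
  (∫⁻ x, f x ^ r ∂μ) ^ (1 / r)

theorem eLpNorm_eq_lintegralLp {ε : Type*} [TopologicalSpace ε] [ContinuousENorm ε] {p : ℝ≥0∞}
    (hp : p ≠ 0) (hp' : p ≠ ⊤) (f : α → ε) :
    eLpNorm f p μ = lintegralLp p.toReal μ fun x => ‖f x‖ₑ :=
  eLpNorm_eq_lintegral_rpow_enorm_toReal hp hp'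

theorem lintegralLp_mono (hr : 0 ≤ r) {f g : α → ℝ≥0∞} (h : ∀ x, f x ≤ g x) :
    lintegralLp r μ f ≤ lintegralLp r μ g := by
  unfold lintegralLp
  gcongr with x
  exact h x

theorem lintegralLp_const_mul (hr : 0 < r) (c : ℝ≥0∞) {f : α → ℝ≥0∞} (hf : Measurable f) :
    lintegralLp r μ (fun x => c * f x) = c * lintegralLp r μ f := by
  unfold lintegralLp
  simp only [ENNReal.mul_rpow_of_nonneg _ _ hr.le]
  rw [lintegral_const_mul _ (hf.pow_const r), ENNReal.mul_rpow_of_nonneg _ _ (by positivity),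
    ← ENNReal.rpow_mul, mul_one_div_cancel hr.ne', ENNReal.rpow_one]

theorem lintegralLp_add_le (hr : 1 ≤ r) {f g : α → ℝ≥0∞} (hf : Measurable f) (hg : Measurable g) :
    lintegralLp r μ (fun x => f x + g x) ≤ lintegralLp r μ f + lintegralLp r μ g :=
  ENNReal.lintegral_Lp_add_le hf.aemeasurable hg.aemeasurable hr

theorem lintegralLp_lt_top_iff (hr : 0 < r) {f : α → ℝ≥0∞} :
    lintegralLp r μ f < ⊤ ↔ ∫⁻ x, f x ^ r ∂μ < ⊤ :=
  ENNReal.rpow_lt_top_iff_of_pos (by positivity)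

theorem measurable_lintegralLp [SFinite μ] {f : β → α → ℝ≥0∞}
    (hf : Measurable (Function.uncurry f)) : Measurable fun y => lintegralLp r μ (f y) :=
  (Measurable.lintegral_prod_right' (hf.pow_const r)).pow_const _

theorem ae_lt_top_of_lintegralLp (hr : 0 < r) {f : α → ℝ≥0∞} (hf : Measurable f)
    (h : lintegralLp r μ f < ⊤) : ∀ᵐ x ∂μ, f x < ⊤ := by
  filter_upwards [ae_lt_top (hf.pow_const r) ((lintegralLp_lt_top_iff hr).1 h).ne] with x hx
  exact (ENNReal.rpow_lt_top_iff_of_pos hr).1 hx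

theorem tendsto_lintegralLp_zero (hr : 0 < r) {ι : Type*} {l : Filter ι} [l.IsCountablyGenerated]
    {f : ι → α → ℝ≥0∞} {v : α → ℝ≥0∞} (hf : ∀ᶠ i in l, Measurable (f i))
    (hfv : ∀ᶠ i in l, ∀ x, f i x ≤ v x) (hv : lintegralLp r μ v < ⊤)
    (hlim : ∀ᵐ x ∂μ, Tendsto (fun i => f i x) l (𝓝 0)) :
    Tendsto (fun i => lintegralLp r μ (f i)) l (𝓝 0) := by
  have h : Tendsto (fun i => ∫⁻ x, f i x ^ r ∂μ) l (𝓝 (∫⁻ _, 0 ∂μ)) := by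
    refine tendsto_lintegral_filter_of_dominated_convergence (fun x => v x ^ r)
      (hf.mono fun i hi => hi.pow_const r) (hfv.mono fun i hi => .of_forall fun x => ?_)
      ((lintegralLp_lt_top_iff hr).1 hv).ne (hlim.mono fun x hx => ?_)
    · exact ENNReal.rpow_le_rpow (hi x) hr.le
    · simpa [hr] using hx.ennrpow_const r
  rw [lintegral_zero] at h
  have hr' : 0 < 1 / r := by positivity
  simpa only [lintegralLp, ENNReal.zero_rpow_of_pos hr'] using h.ennrpow_const (1 / r)

/-- The main step of Minkowski's integral inequality, for a truncation `T` of the integral. -/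
theorem lintegralLp_le_of_le_lintegral [SFinite μ] [SFinite ν] (hr : 1 < r)
    {K : α → β → ℝ≥0∞} (hK : Measurable (Function.uncurry K)) {T : α → ℝ≥0∞} (hT : Measurable T)
    (hTK : ∀ x, T x ≤ ∫⁻ y, K x y ∂ν) (hT' : ∫⁻ x, T x ^ r ∂μ ≠ ⊤) :
    lintegralLp r μ T ≤ ∫⁻ y, lintegralLp r μ (fun x => K x y) ∂ν := by
  have hr₀ : 0 < r := by linarith
  have hc : r.HolderConjugate r.conjExponent := .conjExponent hr
  set I := ∫⁻ x, T x ^ r ∂μ with hI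
  have hKs : ∀ x, Measurable (K x) := fun x => hK.of_uncurry_left
  have hKs' : ∀ y, Measurable fun x => K x y := fun y => hK.of_uncurry_right
  -- Write `T ^ r = T ^ (r - 1) * T`, bound the last factor by the integral of `K`, exchange the
  -- integrals, and apply Hölder in `x`. Dividing by the power of `I` afterwards uses that `I` is
  -- finite.
  have key : I ≤ I ^ (1 / r.conjExponent) * ∫⁻ y, lintegralLp r μ (fun x => K x y) ∂ν := by
    calc I ≤ ∫⁻ x, T x ^ (r - 1) * ∫⁻ y, K x y ∂ν ∂μ := by
          refine lintegral_mono fun x => ?_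
          calc T x ^ r = T x ^ (r - 1 + 1) := by rw [sub_add_cancel]
            _ = T x ^ (r - 1) * T x := by
                rw [ENNReal.rpow_add_of_nonneg _ _ (by linarith) zero_le_one, ENNReal.rpow_one]
            _ ≤ _ := by gcongr; exact hTK x
      _ = ∫⁻ x, ∫⁻ y, T x ^ (r - 1) * K x y ∂ν ∂μ := by
          simp only [lintegral_const_mul _ (hKs _)]
      _ = ∫⁻ y, ∫⁻ x, T x ^ (r - 1) * K x y ∂μ ∂ν := by
          refine lintegral_lintegral_swap (Measurable.aemeasurable ?_)
          exact ((hT.comp measurable_fst).pow_const _).mul hK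
      _ ≤ ∫⁻ y, I ^ (1 / r.conjExponent) * lintegralLp r μ (fun x => K x y) ∂ν := by
          refine lintegral_mono fun y => ?_
          refine (ENNReal.lintegral_mul_le_Lp_mul_Lq μ hc.symm
            (hT.pow_const (r - 1)).aemeasurable (hKs' y).aemeasurable).trans_eq ?_
          simp only [← ENNReal.rpow_mul, hc.sub_one_mul_conj]
          rfl
      _ = _ := lintegral_const_mul _ (measurable_lintegralLp (f := fun y x => K x y)
          (hK.comp measurable_swap))
  by_cases hI0 : I = 0
  · rw [lintegralLp, ← hI, hI0, ENNReal.zero_rpow_of_pos (by positivity)]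
    exact zero_le
  · have hsplit : I = I ^ (1 / r.conjExponent) * I ^ (1 / r) := by
      rw [← ENNReal.rpow_add _ _ hI0 hT', one_div, one_div, add_comm, hc.inv_add_inv_eq_one,
        ENNReal.rpow_one]
    nth_rw 1 [hsplit] at key
    refine (ENNReal.mul_le_mul_iff_right ?_ ?_).1 key
    · simp [ENNReal.rpow_eq_zero_iff, hI0, hT']
    · exact (ENNReal.rpow_lt_top_of_nonneg (one_div_nonneg.2 hc.symm.nonneg) hT').ne

/-- **Minkowski's integral inequality**. -/
theorem lintegralLp_lintegral_le [SigmaFinite μ] [SFinite ν] (hr : 1 ≤ r)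
    {K : α → β → ℝ≥0∞} (hK : Measurable (Function.uncurry K)) :
    lintegralLp r μ (fun x => ∫⁻ y, K x y ∂ν) ≤ ∫⁻ y, lintegralLp r μ (fun x => K x y) ∂ν := by
  rcases hr.eq_or_lt with rfl | hr
  · simp only [lintegralLp, ENNReal.rpow_one, div_one]
    exact (lintegral_lintegral_swap hK.aemeasurable).le
  have hr₀ : 0 < r := by linarith
  set S : α → ℝ≥0∞ := fun x => ∫⁻ y, K x y ∂ν with hS
  have hSm : Measurable S := Measurable.lintegral_prod_right' hK
  -- Truncating in height and to sets of finite measure makes the `r`-th power integrable; Fatou's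
  -- lemma then removes the truncation.
  let T : ℕ → α → ℝ≥0∞ := fun k => (spanningSets μ k).indicator fun x => min (S x) k
  have hTm : ∀ k, Measurable (T k) := fun k =>
    (hSm.min measurable_const).indicator (measurableSet_spanningSets μ k)
  have hTS : ∀ k x, T k x ≤ S x := fun k x =>
    Set.indicator_apply_le' (fun _ => min_le_left _ _) fun _ => zero_le
  have hTfin : ∀ k, ∫⁻ x, T k x ^ r ∂μ ≠ ⊤ := by
    intro k
    refine ne_top_of_le_ne_top (b := (k : ℝ≥0∞) ^ r * μ (spanningSets μ k)) ?_ ?_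
    · exact ENNReal.mul_ne_top (ENNReal.rpow_lt_top_of_nonneg hr₀.le (ENNReal.natCast_ne_top k)).ne
        (measure_spanningSets_lt_top μ k).ne
    · rw [← lintegral_indicator_const (measurableSet_spanningSets μ k)]
      refine lintegral_mono fun x => ?_
      by_cases hx : x ∈ spanningSets μ k
      · simp only [T, Set.indicator_of_mem hx]
        exact ENNReal.rpow_le_rpow (min_le_right _ _) hr₀.le
      · simp [T, Set.indicator_of_notMem hx, hr₀]
  have hTlim : ∀ x, Tendsto (fun k => T k x ^ r) atTop (𝓝 (S x ^ r)) := by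
    intro x
    refine Tendsto.ennrpow_const r ?_
    have h₁ : Tendsto (fun k : ℕ => min (S x) (k : ℝ≥0∞)) atTop (𝓝 (S x)) := by
      simpa using (tendsto_const_nhds (x := S x)).min ENNReal.tendsto_nat_nhds_top
    refine h₁.congr' ?_
    filter_upwards [eventually_ge_atTop (spanningSetsIndex μ x)] with k hk
    exact (Set.indicator_of_mem
      (monotone_spanningSets μ hk (mem_spanningSetsIndex μ x)) fun x => min (S x) (k : ℝ≥0∞)).symm
  set A := ∫⁻ y, lintegralLp r μ (fun x => K x y) ∂ν
  have hA : ∀ k, ∫⁻ x, T k x ^ r ∂μ ≤ A ^ r := by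
    intro k
    have := lintegralLp_le_of_le_lintegral hr hK (hTm k) (hTS k) (hTfin k)
    rwa [lintegralLp, one_div, ENNReal.rpow_inv_le_iff hr₀] at this
  rw [lintegralLp, one_div, ENNReal.rpow_inv_le_iff hr₀]
  calc ∫⁻ x, S x ^ r ∂μ = ∫⁻ x, liminf (fun k => T k x ^ r) atTop ∂μ :=
        lintegral_congr fun x => (hTlim x).liminf_eq.symm
    _ ≤ liminf (fun k => ∫⁻ x, T k x ^ r ∂μ) atTop :=
        lintegral_liminf_le fun k => (hTm k).pow_const r
    _ ≤ liminf (fun _ : ℕ => A ^ r) atTop := liminf_le_liminf (.of_forall hA)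
    _ = A ^ r := liminf_const _

end LintegralLp

/-! ### Weighted mixed norms. -/

section MixedNorm

variable {α β γ : Type*} [MeasurableSpace α] [MeasurableSpace β] [MeasurableSpace γ]
  {μ : Measure α} {ν : Measure β} {κ : Measure γ} {r t : ℝ} {w : β → ℝ≥0∞}

/-- The mixed norm `‖ξ ↦ w(ξ) ‖G(·, ξ)‖_{L^r(μ)}‖_{L^t(ν)}`. -/
def mixedNorm (r t : ℝ) (μ : Measure α) (ν : Measure β) (w : β → ℝ≥0∞) (G : α → β → ℝ≥0∞) :
    ℝ≥0∞ :=
  lintegralLp t ν fun ξ => w ξ * lintegralLp r μ fun x => G x ξ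

theorem mixedNorm_mono (hr : 0 ≤ r) (ht : 0 ≤ t) {G G' : α → β → ℝ≥0∞}
    (h : ∀ x ξ, G x ξ ≤ G' x ξ) : mixedNorm r t μ ν w G ≤ mixedNorm r t μ ν w G' :=
  lintegralLp_mono ht fun ξ => mul_le_mul_right (lintegralLp_mono hr fun x => h x ξ) _

theorem measurable_mul_lintegralLp [SFinite μ] (hw : Measurable w) {G : α → β → ℝ≥0∞}
    (hG : Measurable (Function.uncurry G)) :
    Measurable fun ξ => w ξ * lintegralLp r μ fun x => G x ξ :=
  hw.mul (measurable_lintegralLp (f := fun ξ x => G x ξ) (hG.comp measurable_swap))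

theorem mixedNorm_const_mul [SFinite μ] (hr : 0 < r) (ht : 0 < t) (hw : Measurable w)
    (c : ℝ≥0∞) {G : α → β → ℝ≥0∞} (hG : Measurable (Function.uncurry G)) :
    mixedNorm r t μ ν w (fun x ξ => c * G x ξ) = c * mixedNorm r t μ ν w G := by
  unfold mixedNorm
  rw [← lintegralLp_const_mul ht c (measurable_mul_lintegralLp hw hG)]
  congr 1
  ext ξ
  rw [lintegralLp_const_mul hr c hG.of_uncurry_right, mul_left_comm]

theorem mixedNorm_add_le [SFinite μ] (hr : 1 ≤ r) (ht : 1 ≤ t) (hw : Measurable w)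
    {G G' : α → β → ℝ≥0∞} (hG : Measurable (Function.uncurry G))
    (hG' : Measurable (Function.uncurry G')) :
    mixedNorm r t μ ν w (fun x ξ => G x ξ + G' x ξ) ≤
      mixedNorm r t μ ν w G + mixedNorm r t μ ν w G' := by
  refine le_trans (lintegralLp_mono (by linarith) fun ξ => ?_) (lintegralLp_add_le ht
    (measurable_mul_lintegralLp hw hG) (measurable_mul_lintegralLp hw hG'))
  rw [← mul_add]
  gcongr
  exact lintegralLp_add_le hr hG.of_uncurry_right hG'.of_uncurry_right

/-- Minkowski's inequality is used twice, for the inner norm at fixed `ξ` and then for the outer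
norm. -/
theorem mixedNorm_lintegral_le [SigmaFinite μ] [SigmaFinite ν] [SFinite κ] (hr : 1 ≤ r)
    (ht : 1 ≤ t) (hw : Measurable w) {G : γ → α → β → ℝ≥0∞}
    (hG : Measurable fun z : γ × α × β => G z.1 z.2.1 z.2.2) :
    mixedNorm r t μ ν w (fun x ξ => ∫⁻ η, G η x ξ ∂κ) ≤ ∫⁻ η, mixedNorm r t μ ν w (G η) ∂κ := by
  have h₁ : Measurable fun z : (β × γ) × α => G z.1.2 z.2 z.1.1 :=
    hG.comp (measurable_fst.snd.prodMk (measurable_snd.prodMk measurable_fst.fst))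
  have h₂ : Measurable fun z : β × γ => lintegralLp r μ fun x => G z.2 x z.1 :=
    measurable_lintegralLp (f := fun (z : β × γ) x => G z.2 x z.1) h₁
  calc mixedNorm r t μ ν w (fun x ξ => ∫⁻ η, G η x ξ ∂κ)
      ≤ lintegralLp t ν fun ξ => ∫⁻ η, w ξ * lintegralLp r μ (fun x => G η x ξ) ∂κ := by
        refine lintegralLp_mono (by linarith) fun ξ => ?_
        have h₃ : Measurable fun η => lintegralLp r μ fun x => G η x ξ :=
          h₂.comp measurable_prodMk_left
        rw [lintegral_const_mul _ h₃]
        gcongr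
        exact lintegralLp_lintegral_le hr (K := fun x η => G η x ξ)
          (hG.comp (measurable_snd.prodMk (measurable_fst.prodMk measurable_const)))
    _ ≤ _ := lintegralLp_lintegral_le ht
        (K := fun ξ η => w ξ * lintegralLp r μ (fun x => G η x ξ))
        ((hw.comp measurable_fst).mul h₂)

theorem measurable_mixedNorm [SFinite μ] [SFinite ν] (hw : Measurable w) {G : γ → α → β → ℝ≥0∞}
    (hG : Measurable fun z : γ × α × β => G z.1 z.2.1 z.2.2) :
    Measurable fun η => mixedNorm r t μ ν w (G η) := by
  have h₁ : Measurable fun z : (γ × β) × α => G z.1.1 z.2 z.1.2 :=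
    hG.comp (measurable_fst.fst.prodMk (measurable_snd.prodMk measurable_fst.snd))
  exact measurable_lintegralLp (f := fun η ξ => w ξ * lintegralLp r μ fun x => G η x ξ)
    ((hw.comp measurable_snd).mul
      (measurable_lintegralLp (f := fun (z : γ × β) x => G z.1 x z.2) h₁))

/-- By invariance of `ν`, the shift passes from the function to the weight. -/
theorem mixedNorm_sub_right_le [AddGroup β] [MeasurableAdd β] [ν.IsAddRightInvariant] [SFinite μ]
    (ht : 0 < t) (hw : Measurable w) {G : α → β → ℝ≥0∞}
    (hG : Measurable (Function.uncurry G)) {a : β} {C : ℝ≥0∞} (hC : ∀ ξ, w (ξ + a) ≤ C * w ξ) :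
    mixedNorm r t μ ν w (fun x ξ => G x (ξ - a)) ≤ C * mixedNorm r t μ ν w G := by
  have h := lintegral_sub_right_eq_self (μ := ν)
    (fun ξ => (w (ξ + a) * lintegralLp r μ fun x => G x ξ) ^ t) a
  simp only [sub_add_cancel] at h
  calc mixedNorm r t μ ν w (fun x ξ => G x (ξ - a))
      = lintegralLp t ν fun ξ => w (ξ + a) * lintegralLp r μ fun x => G x ξ := by
        rw [mixedNorm, lintegralLp, h, lintegralLp]
    _ ≤ lintegralLp t ν fun ξ => C * (w ξ * lintegralLp r μ fun x => G x ξ) := by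
        refine lintegralLp_mono ht.le fun ξ => ?_
        rw [← mul_assoc]
        gcongr
        exact hC ξ
    _ = _ := lintegralLp_const_mul ht C (measurable_mul_lintegralLp hw hG)

/-- Dominated convergence for the inner norm, then for the outer one. Finiteness of the outer norm
of `V`, with a nonvanishing weight, gives a finite inner dominating norm at almost every `ξ`. -/
theorem tendsto_mixedNorm_zero [SFinite μ] (hr : 0 < r) (ht : 0 < t) (hw : Measurable w)
    (hw₀ : ∀ ξ, w ξ ≠ 0) (hw₁ : ∀ ξ, w ξ ≠ ⊤) {ι : Type*} {l : Filter ι} [l.IsCountablyGenerated]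
    {G : ι → α → β → ℝ≥0∞} {V : α → β → ℝ≥0∞} (hG : ∀ i, Measurable (Function.uncurry (G i)))
    (hVm : Measurable (Function.uncurry V)) (hGV : ∀ᶠ i in l, ∀ x ξ, G i x ξ ≤ V x ξ)
    (hV : mixedNorm r t μ ν w V < ⊤) (hlim : ∀ x ξ, Tendsto (fun i => G i x ξ) l (𝓝 0)) :
    Tendsto (fun i => mixedNorm r t μ ν w (G i)) l (𝓝 0) := by
  refine tendsto_lintegralLp_zero ht
    (.of_forall fun i => measurable_mul_lintegralLp hw (hG i)) (hGV.mono fun i hi ξ => ?_) hV ?_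
  · gcongr
    exact lintegralLp_mono hr.le fun x => hi x ξ
  · filter_upwards [ae_lt_top_of_lintegralLp ht (measurable_mul_lintegralLp hw hVm) hV] with ξ hξ
    have hξ' : lintegralLp r μ (fun x => V x ξ) < ⊤ := by
      by_contra h
      rw [not_lt_top_iff.1 h, ENNReal.mul_top (hw₀ ξ)] at hξ
      exact lt_irrefl _ hξ
    have h₁ := tendsto_lintegralLp_zero hr
      (.of_forall fun i => (hG i).of_uncurry_right (y := ξ))
      (hGV.mono fun i hi x => hi x ξ) hξ' (.of_forall fun x => hlim x ξ)
    simpa using ENNReal.Tendsto.const_mul h₁ (Or.inr (hw₁ ξ))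

end MixedNorm

/-! ### Cutoffs and continuity of frequency translation in the mixed norm. -/

section Cutoff

variable {E : Type*} [NormedAddCommGroup E]

/-- A continuous cutoff function on `E × E`, equal to one for small arguments. -/
def cutoff (R : ℝ) (x ξ : E) : ℝ := max 0 (min 1 (R - (‖x‖ + ‖ξ‖)))

theorem continuous_cutoff (R : ℝ) : Continuous fun z : E × E => cutoff R z.1 z.2 := by
  unfold cutoff
  fun_prop

theorem abs_one_sub_cutoff_le (R : ℝ) (x ξ : E) : |1 - cutoff R x ξ| ≤ 1 := by
  have h₁ : 0 ≤ cutoff R x ξ := le_max_left _ _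
  have h₂ : cutoff R x ξ ≤ 1 := max_le zero_le_one (min_le_left _ _)
  rw [abs_le]
  constructor <;> linarith

theorem cutoff_eq_one {R : ℝ} {x ξ : E} (h : 1 + (‖x‖ + ‖ξ‖) ≤ R) : cutoff R x ξ = 1 := by
  rw [cutoff, min_eq_left (by linarith), max_eq_right zero_le_one]

theorem cutoff_eq_zero {R : ℝ} {x ξ : E} (h : R < ‖x‖ ∨ R < ‖ξ‖) : cutoff R x ξ = 0 := by
  refine max_eq_left (min_le_of_right_le ?_)
  rcases h with h | h <;> linarith [norm_nonneg x, norm_nonneg ξ]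

end Cutoff

section Translation

variable {E : Type*} [NormedAddCommGroup E] [NormedSpace ℝ E] [FiniteDimensional ℝ E]
  [MeasurableSpace E] [BorelSpace E] {μ : Measure E} [μ.IsAddHaarMeasure] {r t : ℝ}
  {w : E → ℝ≥0∞}

theorem lintegralLp_indicator_one_lt_top (hr : 0 < r) {α : Type*} [MeasurableSpace α]
    {μ : Measure α} {s : Set α} (hs : MeasurableSet s) (hμ : μ s < ⊤) :
    lintegralLp r μ (s.indicator 1) < ⊤ := by
  rw [lintegralLp_lt_top_iff hr]
  have : (fun x => s.indicator (1 : α → ℝ≥0∞) x ^ r) = s.indicator 1 := by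
    ext x
    by_cases hx : x ∈ s <;> simp [hx, hr]
  rwa [this, lintegral_indicator_one hs]

theorem mixedNorm_indicator_lt_top (hr : 0 < r) (ht : 0 < t) (hw : Continuous w)
    (hw₁ : ∀ ξ, w ξ ≠ ⊤) {c : ℝ≥0∞} (hc : c ≠ ⊤) (R R' : ℝ) (hR' : 0 ≤ R') :
    mixedNorm r t μ μ w (fun x ξ => c * ((Metric.closedBall (0 : E) R').indicator 1 ξ *
      (Metric.closedBall (0 : E) R).indicator 1 x)) < ⊤ := by
  have hB : ∀ R : ℝ, MeasurableSet (Metric.closedBall (0 : E) R) := fun R => measurableSet_closedBall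
  have hI : ∀ R : ℝ, Measurable ((Metric.closedBall (0 : E) R).indicator (1 : E → ℝ≥0∞)) :=
    fun R => measurable_one.indicator (hB R)
  have hfin : ∀ {r : ℝ}, 0 < r → ∀ R : ℝ,
      lintegralLp r μ ((Metric.closedBall (0 : E) R).indicator 1) < ⊤ := fun hr R =>
    lintegralLp_indicator_one_lt_top hr (hB R) measure_closedBall_lt_top
  rw [mixedNorm_const_mul hr ht hw.measurable c
    (((hI R').comp measurable_snd).mul ((hI R).comp measurable_fst))]
  refine ENNReal.mul_lt_top hc.lt_top ?_
  obtain ⟨ξ₀, -, hξ₀⟩ := (isCompact_closedBall (0 : E) R').exists_isMaxOn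
    ⟨0, Metric.mem_closedBall_self hR'⟩ hw.continuousOn
  set N := lintegralLp r μ ((Metric.closedBall (0 : E) R).indicator 1)
  calc mixedNorm r t μ μ w (fun x ξ => (Metric.closedBall (0 : E) R').indicator 1 ξ *
        (Metric.closedBall (0 : E) R).indicator 1 x)
      ≤ lintegralLp t μ fun ξ => (w ξ₀ * N) * (Metric.closedBall (0 : E) R').indicator 1 ξ := by
        refine lintegralLp_mono ht.le fun ξ => ?_
        rw [lintegralLp_const_mul hr _ (hI R)]
        by_cases hξ : ξ ∈ Metric.closedBall (0 : E) R'
        · simp only [Set.indicator_of_mem hξ, Pi.one_apply, one_mul, mul_one]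
          gcongr
          exact hξ₀ hξ
        · simp [Set.indicator_of_notMem hξ]
    _ = (w ξ₀ * N) * lintegralLp t μ ((Metric.closedBall (0 : E) R').indicator 1) :=
        lintegralLp_const_mul ht _ (hI R')
    _ < ⊤ := ENNReal.mul_lt_top (ENNReal.mul_lt_top (hw₁ ξ₀).lt_top (hfin hr R)) (hfin ht R')

/-- The mixed norm of a translation difference tends to zero if the function is continuous and
vanishes for large arguments. -/
theorem tendsto_mixedNorm_sub_translate_of_support (hr : 0 < r) (ht : 0 < t) (hw : Continuous w)
    (hw₀ : ∀ ξ, w ξ ≠ 0) (hw₁ : ∀ ξ, w ξ ≠ ⊤) {F : E → E → ℂ}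
    (hF : Continuous (Function.uncurry F)) {R : ℝ} (hR : 0 ≤ R)
    (hFR : ∀ x ξ, R < ‖x‖ ∨ R < ‖ξ‖ → F x ξ = 0) :
    Tendsto (fun a : E => mixedNorm r t μ μ w fun x ξ => ‖F x ξ - F x (ξ - a)‖ₑ) (𝓝 0) (𝓝 0) := by
  obtain ⟨M, hM⟩ := ((isCompact_closedBall (0 : E) R).prod
    (isCompact_closedBall (0 : E) R)).exists_bound_of_continuousOn hF.continuousOn
  have hM₀ : 0 ≤ M := (norm_nonneg _).trans (hM (0, 0) (by simp [hR]))
  have hFM : ∀ x ξ, ‖F x ξ‖ ≤ M := by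
    intro x ξ
    by_cases h : R < ‖x‖ ∨ R < ‖ξ‖
    · rwa [hFR x ξ h, norm_zero]
    · push Not at h
      exact hM (x, ξ) (by simpa using h)
  have hc : ∀ a, Continuous fun z : E × E => F z.1 z.2 - F z.1 (z.2 - a) := fun a =>
    hF.sub (hF.comp (continuous_fst.prodMk (continuous_snd.sub continuous_const)))
  have hI : ∀ R : ℝ, Measurable ((Metric.closedBall (0 : E) R).indicator (1 : E → ℝ≥0∞)) :=
    fun R => measurable_one.indicator measurableSet_closedBall
  -- For `‖a‖ ≤ 1` both terms of the difference vanish once `‖ξ‖ > R + 1`, hence the enlarged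
  -- frequency ball; each term is at most `M`.
  refine tendsto_mixedNorm_zero hr ht hw.measurable hw₀ hw₁
    (V := fun x ξ => ENNReal.ofReal (2 * M) * ((Metric.closedBall (0 : E) (R + 1)).indicator 1 ξ *
      (Metric.closedBall (0 : E) R).indicator 1 x))
    (fun a => (hc a).enorm.measurable)
    (measurable_const.mul (((hI _).comp measurable_snd).mul ((hI _).comp measurable_fst))) ?_
    (mixedNorm_indicator_lt_top hr ht hw hw₁ ENNReal.ofReal_ne_top R (R + 1) (by linarith)) ?_
  · filter_upwards [Metric.closedBall_mem_nhds (0 : E) one_pos] with a ha x ξ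
    rw [mem_closedBall_zero_iff] at ha
    by_cases hx : R < ‖x‖
    · simp [hFR x _ (Or.inl hx)]
    by_cases hξ : R + 1 < ‖ξ‖
    · have h₁ : R < ‖ξ - a‖ := by
        have := norm_sub_norm_le ξ a
        linarith
      simp [hFR x ξ (Or.inr (by linarith)), hFR x (ξ - a) (Or.inr h₁)]
    · rw [not_lt] at hx hξ
      rw [Set.indicator_of_mem (by simpa using hξ), Set.indicator_of_mem (by simpa using hx)]
      simp only [Pi.one_apply, mul_one]
      rw [← ofReal_norm]
      gcongr
      refine (norm_sub_le _ _).trans ?_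
      linarith [hFM x ξ, hFM x (ξ - a)]
  · intro x ξ
    have : Continuous fun a => ‖F x ξ - F x (ξ - a)‖ₑ :=
      (continuous_const.sub (hF.comp
        (continuous_const.prodMk (continuous_const.sub continuous_id)))).enorm
    simpa using this.tendsto 0

/-- Translation in the second variable is continuous with respect to a weighted mixed norm. -/
theorem tendsto_mixedNorm_sub_translate (hr : 1 ≤ r) (ht : 1 ≤ t) (hw : Continuous w)
    (hw₀ : ∀ ξ, w ξ ≠ 0) (hw₁ : ∀ ξ, w ξ ≠ ⊤) {C : ℝ≥0∞} (hC : C ≠ ⊤)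
    (hwC : ∀ a ξ, ‖a‖ ≤ 1 → w (ξ + a) ≤ C * w ξ) {F : E → E → ℂ}
    (hF : Continuous (Function.uncurry F)) (hfin : mixedNorm r t μ μ w (fun x ξ => ‖F x ξ‖ₑ) < ⊤) :
    Tendsto (fun a : E => mixedNorm r t μ μ w fun x ξ => ‖F x ξ - F x (ξ - a)‖ₑ) (𝓝 0) (𝓝 0) := by
  have hr₀ : 0 < r := by linarith
  have ht₀ : 0 < t := by linarith
  let A : ℕ → E → E → ℂ := fun j x ξ => cutoff j x ξ * F x ξ
  let B : ℕ → E → E → ℂ := fun j x ξ => ((1 - cutoff j x ξ : ℝ) : ℂ) * F x ξ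
  have hA : ∀ j, Continuous (Function.uncurry (A j)) := fun j =>
    (Complex.continuous_ofReal.comp (continuous_cutoff j)).mul hF
  have hB : ∀ j, Continuous (Function.uncurry (B j)) := fun j =>
    (Complex.continuous_ofReal.comp (continuous_const.sub (continuous_cutoff j))).mul hF
  have hAB : ∀ j x ξ, F x ξ = A j x ξ + B j x ξ := fun j x ξ => by
    simp only [A, B]
    push_cast
    ring
  have hBlim : Tendsto (fun j => mixedNorm r t μ μ w fun x ξ => ‖B j x ξ‖ₑ) atTop (𝓝 0) := by
    refine tendsto_mixedNorm_zero hr₀ ht₀ hw.measurable hw₀ hw₁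
      (V := fun x ξ => ‖F x ξ‖ₑ) (fun j => (hB j).enorm.measurable) hF.enorm.measurable
      (.of_forall fun j x ξ => ?_) hfin fun x ξ => ?_
    · simp only [B]
      rw [enorm_mul]
      refine mul_le_of_le_one_left zero_le ?_
      rw [← ofReal_norm, Complex.norm_real, Real.norm_eq_abs]
      exact ENNReal.ofReal_le_one.2 (abs_one_sub_cutoff_le j x ξ)
    · refine tendsto_const_nhds.congr' ?_
      filter_upwards [eventually_ge_atTop ⌈1 + (‖x‖ + ‖ξ‖)⌉₊] with j hj
      simp [B, cutoff_eq_one (Nat.ceil_le.1 hj)]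
  -- The tail `B j` enters once untranslated and once translated; the translated copy costs the
  -- factor `C`.
  have hBlim' : Tendsto (fun j => (1 + C) * mixedNorm r t μ μ w fun x ξ => ‖B j x ξ‖ₑ) atTop
      (𝓝 0) := by
    simpa using ENNReal.Tendsto.const_mul hBlim (Or.inr (by finiteness))
  rw [ENNReal.tendsto_nhds_zero]
  intro ε hε
  have hε' : 0 < ε / 2 := ENNReal.half_pos hε.ne'
  obtain ⟨j, hj⟩ := (ENNReal.tendsto_nhds_zero.1 hBlim' _ hε').exists
  have hAlim := tendsto_mixedNorm_sub_translate_of_support (μ := μ) hr₀ ht₀ hw hw₀ hw₁ (hA j)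
    (Nat.cast_nonneg j) (fun x ξ h => by simp [A, cutoff_eq_zero h])
  filter_upwards [ENNReal.tendsto_nhds_zero.1 hAlim _ hε',
    Metric.closedBall_mem_nhds (0 : E) one_pos] with a ha ha₁
  rw [mem_closedBall_zero_iff] at ha₁
  have hτ : Continuous fun z : E × E => (z.1, z.2 - a) := by fun_prop
  have hBm : Measurable (Function.uncurry fun x ξ => ‖B j x ξ‖ₑ) := (hB j).enorm.measurable
  have hBτ : Measurable (Function.uncurry fun x ξ => ‖B j x (ξ - a)‖ₑ) :=
    ((hB j).comp hτ).enorm.measurable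
  have hAτ : Measurable (Function.uncurry fun x ξ => ‖A j x ξ - A j x (ξ - a)‖ₑ) :=
    ((hA j).sub ((hA j).comp hτ)).enorm.measurable
  calc mixedNorm r t μ μ w (fun x ξ => ‖F x ξ - F x (ξ - a)‖ₑ)
      ≤ mixedNorm r t μ μ w (fun x ξ => ‖A j x ξ - A j x (ξ - a)‖ₑ +
          (‖B j x ξ‖ₑ + ‖B j x (ξ - a)‖ₑ)) := by
        refine mixedNorm_mono hr₀.le ht₀.le fun x ξ => ?_
        rw [hAB j x ξ, hAB j x (ξ - a), add_sub_add_comm]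
        exact (enorm_add_le _ _).trans (add_le_add le_rfl enorm_sub_le)
    _ ≤ ε / 2 + (mixedNorm r t μ μ w (fun x ξ => ‖B j x ξ‖ₑ) +
          C * mixedNorm r t μ μ w (fun x ξ => ‖B j x ξ‖ₑ)) := by
        refine (mixedNorm_add_le hr ht hw.measurable hAτ
          (G' := fun x ξ => ‖B j x ξ‖ₑ + ‖B j x (ξ - a)‖ₑ) (hBm.add hBτ)).trans (add_le_add ha ?_)
        refine (mixedNorm_add_le hr ht hw.measurable hBm hBτ).trans (add_le_add le_rfl ?_)
        exact mixedNorm_sub_right_le ht₀ hw.measurable hBm fun ξ => hwC a ξ ha₁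
    _ ≤ ε / 2 + ε / 2 := by
        gcongr
        rwa [add_mul, one_mul] at hj
    _ = ε := ENNReal.add_halves ε

/-- Averaging translation differences against a dilated Schwartz density. -/
theorem tendsto_lintegral_mixedNorm_sub_translate (hr : 1 ≤ r) (ht : 1 ≤ t) (hw : Continuous w)
    (hw₀ : ∀ ξ, w ξ ≠ 0) (hw₁ : ∀ ξ, w ξ ≠ ⊤) {N : ℕ}
    (hwN : ∀ a ξ, w (ξ + a) ≤ ENNReal.ofReal ((1 + ‖a‖) ^ N) * w ξ) {F : E → E → ℂ}
    (hF : Continuous (Function.uncurry F)) (hfin : mixedNorm r t μ μ w (fun x ξ => ‖F x ξ‖ₑ) < ⊤)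
    (ψ : 𝓢(E, ℂ)) :
    Tendsto (fun c : ℝ => ∫⁻ η, ‖ψ η‖ₑ *
      mixedNorm r t μ μ w (fun x ξ => ‖F x ξ - F x (ξ - c • η)‖ₑ) ∂μ) (𝓝 0) (𝓝 0) := by
  have ht₀ : 0 < t := by linarith
  set X := mixedNorm r t μ μ w (fun x ξ => ‖F x ξ‖ₑ) with hX
  have hlim := tendsto_mixedNorm_sub_translate (μ := μ) (C := ENNReal.ofReal (2 ^ N)) hr ht hw hw₀
    hw₁ ENNReal.ofReal_ne_top (fun a ξ ha => (hwN a ξ).trans (by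
      gcongr
      linarith)) hF hfin
  -- A crude bound valid for all shifts, not only small ones: it supplies the dominating function
  -- for the average over `η`.
  have hbound : ∀ a : E, mixedNorm r t μ μ w (fun x ξ => ‖F x ξ - F x (ξ - a)‖ₑ) ≤
      2 * ENNReal.ofReal ((1 + ‖a‖) ^ N) * X := by
    intro a
    have hτ : Continuous fun z : E × E => (z.1, z.2 - a) := by fun_prop
    have hFm : Measurable (Function.uncurry fun x ξ => ‖F x ξ‖ₑ) := hF.enorm.measurable
    have hFτ : Measurable (Function.uncurry fun x ξ => ‖F x (ξ - a)‖ₑ) :=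
      (hF.comp hτ).enorm.measurable
    calc _ ≤ mixedNorm r t μ μ w (fun x ξ => ‖F x ξ‖ₑ + ‖F x (ξ - a)‖ₑ) :=
          mixedNorm_mono (by linarith) (by linarith) fun x ξ => enorm_sub_le
      _ ≤ X + ENNReal.ofReal ((1 + ‖a‖) ^ N) * X :=
          (mixedNorm_add_le hr ht hw.measurable hFm hFτ).trans (add_le_add le_rfl
            (mixedNorm_sub_right_le ht₀ hw.measurable hFm (hwN a)))
      _ ≤ ENNReal.ofReal ((1 + ‖a‖) ^ N) * X + ENNReal.ofReal ((1 + ‖a‖) ^ N) * X := by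
          gcongr
          refine le_mul_of_one_le_left zero_le (ENNReal.one_le_ofReal.2 (one_le_pow₀ ?_))
          linarith [norm_nonneg a]
      _ = _ := by ring
  have hmeas : ∀ c : ℝ, Measurable fun η => ‖ψ η‖ₑ *
      mixedNorm r t μ μ w (fun x ξ => ‖F x ξ - F x (ξ - c • η)‖ₑ) := by
    intro c
    refine ψ.continuous.enorm.measurable.mul (measurable_mixedNorm hw.measurable
      (G := fun η x ξ => ‖F x ξ - F x (ξ - c • η)‖ₑ) (Continuous.measurable ?_))
    have h₁ : Continuous fun z : E × E × E => (z.2.1, z.2.2 - c • z.1) := by fun_prop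
    exact ((hF.comp continuous_snd).sub (hF.comp h₁)).enorm
  have h := tendsto_lintegral_filter_of_dominated_convergence (μ := μ) (l := 𝓝 (0 : ℝ))
    (F := fun c η => ‖ψ η‖ₑ * mixedNorm r t μ μ w (fun x ξ => ‖F x ξ - F x (ξ - c • η)‖ₑ))
    (f := fun _ => 0)
    (fun η => 2 * X * ENNReal.ofReal ((1 + ‖η‖) ^ N * ‖ψ η‖)) (.of_forall hmeas) ?_ ?_ ?_
  · simpa using h
  · filter_upwards [Metric.closedBall_mem_nhds (0 : ℝ) one_pos] with c hc
    rw [mem_closedBall_zero_iff] at hc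
    refine .of_forall fun η => ?_
    rw [ENNReal.ofReal_mul (by positivity), ofReal_norm]
    calc _ ≤ ‖ψ η‖ₑ * (2 * ENNReal.ofReal ((1 + ‖η‖) ^ N) * X) := by
          gcongr
          refine (hbound _).trans ?_
          gcongr
          rw [norm_smul]
          exact mul_le_of_le_one_left (norm_nonneg η) hc
      _ = _ := by ring
  · rw [lintegral_const_mul' _ _ (by finiteness)]
    exact ENNReal.mul_ne_top (by finiteness)
      (ψ.integrable_one_add_pow_mul (μ := μ) N).lintegral_lt_top.ne
  · refine .of_forall fun η => ?_
    have h₁ : Tendsto (fun c : ℝ => c • η) (𝓝 0) (𝓝 0) := by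
      have : Continuous fun c : ℝ => c • η := by fun_prop
      simpa using this.tendsto 0
    simpa using ENNReal.Tendsto.const_mul (hlim.comp h₁) (Or.inr (enorm_ne_top (x := ψ η)))

/-- Averages of translation differences are controlled by the mixed norms of the differences. -/
theorem mixedNorm_integral_sub_translate_le (hr : 1 ≤ r) (ht : 1 ≤ t) (hw : Measurable w)
    {F G : E → E → ℂ} (hF : Continuous (Function.uncurry F)) (ψ : 𝓢(E, ℂ)) {c : ℝ}
    (hG : ∀ x ξ, G x ξ = ∫ η, ψ η * (F x ξ - F x (ξ - c • η)) ∂μ) :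
    mixedNorm r t μ μ w (fun x ξ => ‖G x ξ‖ₑ) ≤
      ∫⁻ η, ‖ψ η‖ₑ * mixedNorm r t μ μ w (fun x ξ => ‖F x ξ - F x (ξ - c • η)‖ₑ) ∂μ := by
  have hD : Continuous fun z : E × E × E => F z.2.1 z.2.2 - F z.2.1 (z.2.2 - c • z.1) := by
    have h₁ : Continuous fun z : E × E × E => (z.2.1, z.2.2 - c • z.1) := by fun_prop
    exact (hF.comp continuous_snd).sub (hF.comp h₁)
  calc _ ≤ mixedNorm r t μ μ w (fun x ξ => ∫⁻ η, ‖ψ η‖ₑ * ‖F x ξ - F x (ξ - c • η)‖ₑ ∂μ) := by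
        refine mixedNorm_mono (by linarith) (by linarith) fun x ξ => ?_
        rw [hG]
        simpa only [enorm_mul] using enorm_integral_le_lintegral_enorm
          fun η => ψ η * (F x ξ - F x (ξ - c • η))
    _ ≤ ∫⁻ η, mixedNorm r t μ μ w (fun x ξ => ‖ψ η‖ₑ * ‖F x ξ - F x (ξ - c • η)‖ₑ) ∂μ :=
        mixedNorm_lintegral_le hr ht hw (G := fun η x ξ => ‖ψ η‖ₑ * ‖F x ξ - F x (ξ - c • η)‖ₑ)
          ((ψ.continuous.comp continuous_fst).enorm.measurable.mul hD.enorm.measurable)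
    _ = _ := by
        refine lintegral_congr fun η => ?_
        exact mixedNorm_const_mul (by linarith) (by linarith) hw _
          (hD.enorm.measurable.comp measurable_prodMk_left)

end Translation

/-! ### The weight, the dilated bump and the conclusion. -/

/-- The weight `⟨ξ⟩^s` of the modulation space norm. -/
def modulationWeight {n : ℕ} (s : ℝ) (ξ : EuclideanSpace ℝ (Fin n)) : ℝ≥0∞ :=
  ENNReal.ofReal (Real.sqrt (1 + ‖ξ‖ ^ 2) ^ s)

theorem sqrt_one_add_norm_sq_add_le {E : Type*} [NormedAddCommGroup E] (ξ a : E) :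
    Real.sqrt (1 + ‖ξ + a‖ ^ 2) ≤ (1 + ‖a‖) * Real.sqrt (1 + ‖ξ‖ ^ 2) := by
  have h₁ : ‖ξ‖ ≤ Real.sqrt (1 + ‖ξ‖ ^ 2) := Real.le_sqrt_of_sq_le (by linarith)
  have h₂ : 1 ≤ Real.sqrt (1 + ‖ξ‖ ^ 2) := Real.one_le_sqrt.2 (by nlinarith [norm_nonneg ξ])
  have h₃ := Real.sq_sqrt (show 0 ≤ 1 + ‖ξ‖ ^ 2 by positivity)
  refine Real.sqrt_le_iff.2 ⟨by positivity, ?_⟩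
  calc 1 + ‖ξ + a‖ ^ 2 ≤ 1 + (‖ξ‖ + ‖a‖) ^ 2 := by
        gcongr
        exact norm_add_le ξ a
    _ ≤ (Real.sqrt (1 + ‖ξ‖ ^ 2) + ‖a‖) ^ 2 := by
        nlinarith [norm_nonneg a]
    _ ≤ _ := by
        gcongr
        nlinarith [norm_nonneg a]

/-- The exponent `|s|` is rounded up to a natural number so that the growth can be matched with
Schwartz decay. -/
theorem modulationWeight_add_le {n : ℕ} (s : ℝ) (a ξ : EuclideanSpace ℝ (Fin n)) :
    modulationWeight s (ξ + a) ≤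
      ENNReal.ofReal ((1 + ‖a‖) ^ ⌈|s|⌉₊) * modulationWeight s ξ := by
  rw [modulationWeight, modulationWeight, ← ENNReal.ofReal_mul (by positivity)]
  refine ENNReal.ofReal_le_ofReal ?_
  have hJ : ∀ ξ : EuclideanSpace ℝ (Fin n), 0 < Real.sqrt (1 + ‖ξ‖ ^ 2) := fun ξ =>
    Real.sqrt_pos.2 (by positivity)
  have ha : 0 < 1 + ‖a‖ := by positivity
  have ha₁ : 1 ≤ 1 + ‖a‖ := by linarith [norm_nonneg a]
  have hpow : (1 + ‖a‖) ^ |s| ≤ (1 + ‖a‖) ^ ⌈|s|⌉₊ := by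
    rw [← Real.rpow_natCast]
    exact Real.rpow_le_rpow_of_exponent_le ha₁ (Nat.le_ceil _)
  refine le_trans ?_ (mul_le_mul_of_nonneg_right hpow (Real.rpow_nonneg (hJ ξ).le s))
  rcases le_total 0 s with hs | hs
  · rw [abs_of_nonneg hs, ← Real.mul_rpow ha.le (hJ ξ).le]
    exact Real.rpow_le_rpow (hJ _).le (sqrt_one_add_norm_sq_add_le ξ a) hs
  -- For negative `s` powers reverse inequalities, so the comparison is applied from `ξ + a` back to
  -- `ξ`.
  · have h := sqrt_one_add_norm_sq_add_le (ξ + a) (-a)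
    rw [add_neg_cancel_right, norm_neg] at h
    have h' := Real.rpow_le_rpow_of_nonpos (hJ ξ) h hs
    rw [Real.mul_rpow ha.le (hJ _).le] at h'
    rw [abs_of_nonpos hs, Real.rpow_neg ha.le]
    rwa [le_inv_mul_iff₀ (Real.rpow_pos_of_pos ha s)]

theorem continuous_modulationWeight {n : ℕ} (s : ℝ) :
    Continuous (modulationWeight (n := n) s) := by
  refine ENNReal.continuous_ofReal.comp (Continuous.rpow_const (by fun_prop) fun ξ => Or.inl ?_)
  exact (Real.sqrt_pos.2 (by positivity)).ne'

theorem modulationWeight_ne_zero {n : ℕ} (s : ℝ) (ξ : EuclideanSpace ℝ (Fin n)) :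
    modulationWeight s ξ ≠ 0 := by
  rw [modulationWeight, ENNReal.ofReal_ne_zero_iff]
  exact Real.rpow_pos_of_pos (Real.sqrt_pos.2 (by positivity)) s

theorem modulationNorm_eq_mixedNorm {n : ℕ} {p q : ℝ≥0∞} (hp : p ≠ 0) (hp' : p ≠ ⊤) (hq : q ≠ 0)
    (hq' : q ≠ ⊤) (s : ℝ) (g : 𝓢(EuclideanSpace ℝ (Fin n), ℂ))
    (f : 𝓢'(EuclideanSpace ℝ (Fin n), ℂ)) :
    modulationNorm g p q s f = mixedNorm p.toReal q.toReal volume volume (modulationWeight s)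
      (fun x ξ => ‖stft g f x ξ‖ₑ) := by
  rw [modulationNorm, eLpNorm_eq_lintegralLp hq hq']
  simp only [enorm_eq_self, eLpNorm_eq_lintegralLp hp hp']
  rfl

theorem exists_schwartz_hasCompactSupport_apply_zero_eq_one (n : ℕ) :
    ∃ b : 𝓢(EuclideanSpace ℝ (Fin n), ℂ), HasCompactSupport b ∧ b 0 = 1 := by
  let β : ContDiffBump (0 : EuclideanSpace ℝ (Fin n)) := ⟨1, 2, one_pos, one_lt_two⟩
  have h₁ : HasCompactSupport fun x => (β x : ℂ) :=
    β.hasCompactSupport.comp_left (g := Complex.ofReal) Complex.ofReal_zero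
  have h₂ : ContDiff ℝ ∞ fun x => (β x : ℂ) := Complex.ofRealCLM.contDiff.comp β.contDiff
  refine ⟨h₁.toSchwartzMap h₂, h₁, ?_⟩
  change (β 0 : ℂ) = 1
  rw [β.one_of_mem_closedBall (Metric.mem_closedBall_self zero_le_one), Complex.ofReal_one]

/-- Fourier inversion at `c • t`; the factor `2π` reconciles `planeWave` with the normalisation of
`𝓕`. -/
theorem integral_fourier_mul_planeWave {n : ℕ} (b : 𝓢(EuclideanSpace ℝ (Fin n), ℂ)) (c : ℝ)
    (t : EuclideanSpace ℝ (Fin n)) :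
    ∫ η, (𝓕 b) η * planeWave ((2 * Real.pi * c) • η) t = b (c • t) := by
  have hb : b (c • t) = (𝓕⁻ (𝓕 b)) (c • t) := by rw [FourierTransform.fourierInv_fourier_eq]
  rw [hb, fourierInv_coe, Real.fourierInv_eq]
  refine integral_congr_ae (.of_forall fun η => ?_)
  beta_reduce
  rw [mul_smul, planeWave_two_pi_smul, Circle.smul_def, smul_eq_mul, mul_comm, inner_smul_left,
    inner_smul_right]
  rfl

theorem modulationNorm_sub_smulLeftCLM_le {n : ℕ} {p q : ℝ≥0∞} (hp : 1 ≤ p) (hp' : p ≠ ⊤)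
    (hq : 1 ≤ q) (hq' : q ≠ ⊤) (s : ℝ) (g ψ : 𝓢(EuclideanSpace ℝ (Fin n), ℂ))
    (f : 𝓢'(EuclideanSpace ℝ (Fin n), ℂ)) {φ : EuclideanSpace ℝ (Fin n) → ℂ} {c : ℝ}
    (hφ : φ.HasTemperateGrowth) (hψ : ∫ η, ψ η = 1)
    (hφψ : ∀ t, φ t = ∫ η, ψ η * planeWave (c • η) t) :
    modulationNorm g p q s (f - TemperedDistribution.smulLeftCLM ℂ φ f) ≤
      ∫⁻ η, ‖ψ η‖ₑ * mixedNorm p.toReal q.toReal volume volume (modulationWeight s)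
        (fun x ξ => ‖stft g f x ξ - stft g f x (ξ - c • η)‖ₑ) := by
  have hr : 1 ≤ p.toReal := by
    simpa using ENNReal.toReal_mono hp' hp
  have ht : 1 ≤ q.toReal := by
    simpa using ENNReal.toReal_mono hq' hq
  rw [modulationNorm_eq_mixedNorm (zero_lt_one.trans_le hp).ne' hp' (zero_lt_one.trans_le hq).ne'
    hq']
  exact mixedNorm_integral_sub_translate_le hr ht (continuous_modulationWeight s).measurable
    (continuous_stft g f) ψ (stft_sub_smulLeftCLM g ψ f hφ hψ hφψ)

theorem mainTheorem8 (n : ℕ) (p q : ℝ≥0∞) (hp : 1 ≤ p) (hp_top : p ≠ ⊤) (hq : 1 ≤ q)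
    (hq_top : q ≠ ⊤) (s : ℝ)
    (hs : (n : ℝ) * (1 - 1 / q.toReal) < s ∨ (q = 1 ∧ 0 ≤ s))
    (g : 𝓢(EuclideanSpace ℝ (Fin n), ℂ)) (hg : g ≠ 0)
    (f : 𝓢'(EuclideanSpace ℝ (Fin n), ℂ)) (hf : f ∈ modulationSpace g p q s)
    (ε : ℝ) (hε : 0 < ε) :
    ∃ φ : EuclideanSpace ℝ (Fin n) → ℂ, ContDiff ℝ ∞ φ ∧ HasCompactSupport φ ∧
      modulationNorm g p q s (f - TemperedDistribution.smulLeftCLM ℂ φ f) < ENNReal.ofReal ε := by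
  obtain ⟨b, hb, hb₀⟩ := exists_schwartz_hasCompactSupport_apply_zero_eq_one n
  have hf' : modulationNorm g p q s f < ⊤ := hf
  rw [modulationNorm_eq_mixedNorm (zero_lt_one.trans_le hp).ne' hp_top
    (zero_lt_one.trans_le hq).ne' hq_top] at hf'
  have hr : 1 ≤ p.toReal := by
    simpa using ENNReal.toReal_mono hp_top hp
  have ht : 1 ≤ q.toReal := by
    simpa using ENNReal.toReal_mono hq_top hq
  have hlim := tendsto_lintegral_mixedNorm_sub_translate hr ht (continuous_modulationWeight s)
    (modulationWeight_ne_zero s) (fun ξ => ENNReal.ofReal_ne_top) (modulationWeight_add_le s)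
    (continuous_stft g f) hf' (𝓕 b)
  -- The limit is taken along `c ≠ 0`, since the dilated bump is compactly supported only for
  -- nonzero `c`.
  have hc : Tendsto (fun c : ℝ => 2 * Real.pi * c) (𝓝[≠] 0) (𝓝 0) := by
    have : Continuous fun c : ℝ => 2 * Real.pi * c := by fun_prop
    simpa using (this.tendsto 0).mono_left nhdsWithin_le_nhds
  obtain ⟨c, hcε, hc₀⟩ := (((hlim.comp hc).eventually_lt_const (ENNReal.ofReal_pos.2 hε)).and
    self_mem_nhdsWithin).exists
  have h₁ : ContDiff ℝ ∞ fun t => b (c • t) := (b.smooth ⊤).comp (contDiff_const_smul c)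
  have h₂ : HasCompactSupport fun t => b (c • t) := hb.comp_smul hc₀
  refine ⟨fun t => b (c • t), h₁, h₂, lt_of_le_of_lt ?_ hcε⟩
  refine modulationNorm_sub_smulLeftCLM_le hp hp_top hq hq_top s g (𝓕 b) f
    (h₂.hasTemperateGrowth h₁) ?_ fun t => (integral_fourier_mul_planeWave b c t).symm
  -- The case of zero dilation at the origin reads `∫ 𝓕 b = b 0 = 1`.
  simpa [planeWave, hb₀] using integral_fourier_mul_planeWave b 0 0

end
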